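/- Let $S$ be a non-exceptional connected Riemann surface (that is, $\pi_1(S)$ is not abelian), not necessarily of finite type. Write $S=\mathbb{H}^2/\Gamma$, where $\Gamma$ is the deck group of a holomorphic universal covering $\mathbb{H}^2\to S$, and let $k\in\{2,3,\ldots\}\cup\{\infty\}$. Let $\Gamma_k\le\Gamma$ be the subgroup generated by all commutators and, if $k\neq\infty$, all $k$-th powers of elements of $\Gamma$. Let $\widetilde S_k=\mathbb{H}^2/\Gamma_k$ be the $k$-homology cover of $S$, $\pi_k:\widetilde S_k\to S$ the induced covering, and $M_k\le \mathrm{Aut}(\widetilde S_k)$ its deck group. For a subgroup $L\le\mathrm{Aut}(S)$ (conformal automorphisms), let $\widetilde L_k\le\mathrm{Aut}(\widetilde S_k)$ be the group of all lifts $\psi$ of elements of $L$ and $\theta_k:\widetilde L_k\to L$ the homomorphism with $\pi_k\circ\psi=\theta_k(\psi)\circ\pi_k$. Let $\mathcal P=\langle \{\phi_j\}_{j\in J} : \{R_i(\{\phi_j\}_{j\in J})=1\}_{i\in I}\rangle$ be a presentation of $L$, choose $\psi_j\in\widetilde L_k$ with $\theta_k(\psi_j)=\phi_j$, and put $m_i=R_i(\{\psi_j\}_{j\in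 J})\in M_k$. Let $M_{k,\mathcal P}$ be the smallest subgroup of $M_k$ that contains all the $m_i$ and is invariant under conjugation by $\widetilde L_k$. Put $W=\widetilde S_k/M_{k,\mathcal P}$ and $\mathcal G=\widetilde L_k/M_{k,\mathcal P}$, and let $\hat L\le\mathcal G$ be the image of $\langle\psi_j: j\in J\rangle$. If $m_i=1$ for every $i\in I$, then: 1. $M_{k,\mathcal P}=\{1\}$, $W=\widetilde S_k$ (the projection $\widetilde S_k\to W$ is biholomorphic) and $\mathcal G=\widetilde L_k$ (the projection $\widetilde L_k\to\mathcal G$ is an isomorphism); 2. $\theta_k$ induces an isomorphism $\hat L\cong L$; 3. $\widetilde L_k=M_k\rtimes\hat L\cong M_k\rtimes L$ (under $\mathcal G=\widetilde L_k$), where the second isomorphism is the identity on $M_k$, is compatible with the projections onto $L$, and maps $\hat L$ onto $L$ through $\theta_k$; 4. if moreover $S$ is a closed surface of genus $g$, then $M_k\cong\mathbb{Z}_k^{2g}$ (with $\mathbb{Z}_\infty=\mathbb{Z}$) and, correspondingly, $\widetilde L_k\cong\mathbb{Z}_k^{2g}\rtimes L$, compatibly with the projections onto $L$. -/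

import Mathlib

open scoped Manifold ContDiff Topology UpperHalfPlane

noncomputable section

namespace HomologyCover

section Surfaces

/-- The group `Aut(X)` of conformal automorphisms of the Riemann surface `X`: the homeomorphisms
of `X` which are holomorphic together with their inverse. -/
def autGroup (X : Type*) [TopologicalSpace X] [ChartedSpace ℂ X] : Subgroup (X ≃ₜ X) where
  carrier := {f | MDifferentiable 𝓘(ℂ) 𝓘(ℂ) f ∧ MDifferentiable 𝓘(ℂ) 𝓘(ℂ) f.symm}
  mul_mem' := fun ha hb => ⟨ha.1.comp hb.1, hb.2.comp ha.2⟩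
  one_mem' := ⟨mdifferentiable_id, mdifferentiable_id⟩
  inv_mem' := fun ha => ⟨ha.2, ha.1⟩

/-- A homeomorphism of Riemann surfaces is biholomorphic. -/
def IsBiholomorphic {X Y : Type*} [TopologicalSpace X] [ChartedSpace ℂ X]
    [TopologicalSpace Y] [ChartedSpace ℂ Y] (f : X ≃ₜ Y) : Prop :=
  MDifferentiable 𝓘(ℂ) 𝓘(ℂ) f ∧ MDifferentiable 𝓘(ℂ) 𝓘(ℂ) f.symm

/-- The group of conformal deck transformations of a map `f : X → Y`. -/
def deckGroup {X Y : Type*} [TopologicalSpace X] [ChartedSpace ℂ X] (f : X → Y) :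
    Subgroup (X ≃ₜ X) where
  carrier := {g | g ∈ autGroup X ∧ ∀ x, f (g x) = f x}
  mul_mem' := fun {a b} ha hb =>
    ⟨mul_mem ha.1 hb.1, fun x => (ha.2 (b x)).trans (hb.2 x)⟩
  one_mem' := ⟨one_mem _, fun _ => rfl⟩
  inv_mem' := fun {a} ha => ⟨inv_mem ha.1, fun x => by
    have h := ha.2 (a.symm x)
    rw [a.apply_symm_apply] at h
    exact h.symm⟩

variable {X : Type*} [TopologicalSpace X]

/-- The orbit relation of a group of homeomorphisms. -/
def orbitSetoid (G : Subgroup (X ≃ₜ X)) : Setoid X where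
  r x y := ∃ g ∈ G, g x = y
  iseqv :=
    { refl := fun _ => ⟨1, one_mem G, rfl⟩
      symm := by
        rintro x y ⟨g, hg, rfl⟩
        exact ⟨g⁻¹, inv_mem hg, g.symm_apply_apply x⟩
      trans := by
        rintro x y z ⟨g, hg, rfl⟩ ⟨h, hh, rfl⟩
        exact ⟨h * g, mul_mem hh hg, rfl⟩ }

/-- The orbit space `X / G`, with the quotient topology. -/
def OrbitSpace (G : Subgroup (X ≃ₜ X)) : Type _ := Quotient (orbitSetoid G)

instance (G : Subgroup (X ≃ₜ X)) : TopologicalSpace (OrbitSpace G) :=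
  inferInstanceAs (TopologicalSpace (Quotient (orbitSetoid G)))

/-- The projection `X → X / G`. -/
def OrbitSpace.mk (G : Subgroup (X ≃ₜ X)) (x : X) : OrbitSpace G :=
  Quotient.mk (orbitSetoid G) x

namespace OrbitSpace

variable {G : Subgroup (X ≃ₜ X)}

theorem mk_eq_mk {x y : X} : mk G x = mk G y ↔ ∃ g ∈ G, g x = y :=
  ⟨fun h => Quotient.exact h, fun h => Quotient.sound h⟩

theorem mk_apply {g : X ≃ₜ X} (hg : g ∈ G) (x : X) : mk G (g x) = mk G x :=
  (mk_eq_mk.2 ⟨g, hg, rfl⟩).symm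

theorem mk_surjective : Function.Surjective (mk G) := Quotient.mk_surjective

theorem continuous_mk : Continuous (mk G) := continuous_quot_mk

theorem isOpenMap_mk : IsOpenMap (mk G) := by
  intro U hU
  change IsOpen (mk G ⁻¹' (mk G '' U))
  have : mk G ⁻¹' (mk G '' U) = ⋃ g ∈ G, g ⁻¹' U := by
    ext x
    simp only [Set.mem_preimage, Set.mem_image, Set.mem_iUnion, exists_prop]
    constructor
    · rintro ⟨y, hy, h⟩
      obtain ⟨g, hg, rfl⟩ := mk_eq_mk.1 h.symm
      exact ⟨g, hg, hy⟩
    · rintro ⟨g, hg, h⟩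
      exact ⟨g x, h, mk_apply hg x⟩
  rw [this]
  exact isOpen_biUnion fun g _ => hU.preimage g.continuous

end OrbitSpace

/-- The group `G` consists of conformal automorphisms, and every point has a neighbourhood
which is disjoint from its translates by the non-trivial elements of `G`. -/
class IsCoveringAction [ChartedSpace ℂ X] (G : Subgroup (X ≃ₜ X)) : Prop where
  le_autGroup : G ≤ autGroup X
  exists_nhds : ∀ x : X, ∃ U ∈ 𝓝 x, ∀ g ∈ G, ∀ y ∈ U, g y ∈ U → g = 1

theorem isCoveringAction_of_le_deckGroup {Y : Type*} [ChartedSpace ℂ X] [T2Space X]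
    [PreconnectedSpace X] {f : X → Y}
    (hf : ∀ x, ∃ U ∈ 𝓝 x, Set.InjOn f U) {G : Subgroup (X ≃ₜ X)} (hG : G ≤ deckGroup f) :
    IsCoveringAction G where
  le_autGroup := fun _ hg => (hG hg).1
  exists_nhds := by
    intro x
    obtain ⟨U, hU, hinj⟩ := hf x
    refine ⟨U, hU, fun g hg y hy hgy => ?_⟩
    have hfix : g y = y := hinj hgy hy ((hG hg).2 y)
    have hclosed : IsClosed {z | g z = z} := isClosed_eq g.continuous continuous_id
    have hopen : IsOpen {z | g z = z} := by
      rw [isOpen_iff_mem_nhds]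
      intro z hz
      obtain ⟨V, hV, hVinj⟩ := hf z
      have h2 : g ⁻¹' V ∈ 𝓝 z := g.continuous.continuousAt (by rwa [show g z = z from hz])
      filter_upwards [hV, h2] with w hw hw2
      exact hVinj hw2 hw ((hG hg).2 w)
    have huniv := IsClopen.eq_univ ⟨hclosed, hopen⟩ ⟨y, hfix⟩
    ext z
    exact (Set.eq_univ_iff_forall.1 huniv z : _)

/-- The map `X / G → Y` induced by a `G`-invariant map `f : X → Y`. -/
def OrbitSpace.desc {Y : Type*} {G : Subgroup (X ≃ₜ X)} (f : X → Y)
    (hf : ∀ g ∈ G, ∀ x, f (g x) = f x) : OrbitSpace G → Y :=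
  Quotient.lift f (by rintro x y ⟨g, hg, rfl⟩; exact (hf g hg x).symm)

theorem OrbitSpace.t2Space_of_isCoveringMap {Y : Type*} [TopologicalSpace Y] [T2Space Y]
    [LocallyConnectedSpace Y] {G : Subgroup (X ≃ₜ X)} {f : X → Y} (hf : IsCoveringMap f)
    (hG : ∀ g ∈ G, ∀ x, f (g x) = f x) : T2Space (OrbitSpace G) := by
  refine ⟨fun p q hpq => ?_⟩
  obtain ⟨z, rfl⟩ := mk_surjective p
  obtain ⟨w, rfl⟩ := mk_surjective q
  have hcont : Continuous (desc f hG) := hf.continuous.quotient_lift _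
  by_cases hzw : f z = f w
  · have hE := hf (f z)
    have : Nonempty (f ⁻¹' {f z}) := ⟨⟨z, rfl⟩⟩
    let t := hE.toTrivialization
    have ht : f z ∈ t.baseSet := hE.mem_toTrivialization_baseSet
    obtain ⟨B, hBt, hBo, hzB, hBc⟩ :=
      locallyConnectedSpace_iff_subsets_isOpen_isConnected.1 inferInstance (f z) t.baseSet
        (t.open_baseSet.mem_nhds ht)
    have : DiscreteTopology (f ⁻¹' {f z}) := hE.discreteTopology_fiber
    -- the sheet over `B` through a point `a` of the fibre
    let sheet : X → Set X := fun a => f ⁻¹' B ∩ {x | (t x).2 = (t a).2}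
    have hsrc : ∀ x, f x ∈ B → x ∈ t.source := fun x hx => t.mem_source.2 (hBt hx)
    have hopen : ∀ a, IsOpen (sheet a) := by
      intro a
      have h1 : IsOpen (f ⁻¹' B) := hBo.preimage hf.continuous
      have h2 : ContinuousOn (fun x => (t x).2) (f ⁻¹' B) :=
        continuous_snd.comp_continuousOn (t.toOpenPartialHomeomorph.continuousOn.mono fun x hx => hsrc x hx)
      exact h2.isOpen_inter_preimage h1 (isOpen_discrete {(t a).2})
    refine ⟨mk G '' sheet z, mk G '' sheet w, isOpenMap_mk _ (hopen z), isOpenMap_mk _ (hopen w),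
      ⟨z, ⟨hzB, rfl⟩, rfl⟩, ⟨w, ⟨show f w ∈ B from hzw ▸ hzB, rfl⟩, rfl⟩, ?_⟩
    rw [Set.disjoint_left]
    rintro _ ⟨x, ⟨hxB, hx⟩, rfl⟩ ⟨y, ⟨hyB, hy⟩, hyx⟩
    obtain ⟨g, hg, hgx⟩ := mk_eq_mk.1 hyx.symm
    have hxy : f y = f x := by rw [← hgx, hG g hg]
    let σ : (f ⁻¹' {f z}) → Y → X := fun i b => t.toOpenPartialHomeomorph.symm (b, i)
    have hσc : ∀ i, ContinuousOn (σ i) B := fun i =>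
      t.toOpenPartialHomeomorph.continuousOn_symm.comp (by fun_prop)
        (fun b hb => t.mem_target.2 (hBt hb))
    have hσf : ∀ i, ∀ b ∈ B, f (σ i b) = b := fun i b hb => t.proj_symm_apply' (hBt hb)
    have hσ : ∀ a c, f c ∈ B → (t c).2 = (t a).2 → σ (t a).2 (f c) = c := by
      intro a c hc hca
      have : t c = (f c, (t a).2) := Prod.ext (t.coe_fst (hsrc c hc)) hca
      change t.toOpenPartialHomeomorph.symm (f c, (t a).2) = c
      rw [← this]
      exact t.toOpenPartialHomeomorph.left_inv (hsrc c hc)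
    have key := hf.eqOn_of_comp_eqOn hBc.isPreconnected
      (g.continuous.comp_continuousOn (hσc (t z).2)) (hσc (t w).2)
      (fun b hb => by
        simp only [Function.comp_apply]
        rw [hG g hg, hσf _ b hb, hσf _ b hb]) hxB (by
        simp only [Function.comp_apply]
        rw [hσ z x hxB hx, hgx, ← hxy, hσ w y hyB hy])
    have h := key hzB
    simp only [Function.comp_apply] at h
    have hw : σ (t w).2 (f z) = w :=
      (congrArg (σ (t w).2) hzw).trans (hσ w w (hzw ▸ hzB) rfl)
    rw [hσ z z hzB rfl, hw] at h
    exact absurd (mk_eq_mk.2 ⟨g, hg, h⟩) hpq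
  · obtain ⟨U, V, hU, hV, hzU, hwV, hd⟩ := t2_separation hzw
    exact ⟨_, _, hU.preimage hcont, hV.preimage hcont, hzU, hwV, hd.preimage _⟩

namespace OrbitSpace

variable [ChartedSpace ℂ X] (G : Subgroup (X ≃ₜ X))

theorem isLocalHomeomorph_mk [hG : IsCoveringAction G] : IsLocalHomeomorph (mk G) := by
  rw [isLocalHomeomorph_iff_isOpenEmbedding_restrict]
  intro x
  obtain ⟨U, hU, h⟩ := hG.exists_nhds x
  obtain ⟨V, hVU, hV, hxV⟩ := mem_nhds_iff.1 hU
  refine ⟨V, hV.mem_nhds hxV, ?_⟩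
  refine .of_continuous_injective_isOpenMap (continuous_mk.comp continuous_subtype_val) ?_
    (isOpenMap_mk.comp hV.isOpenMap_subtype_val)
  rintro ⟨a, ha⟩ ⟨b, hb⟩ hab
  obtain ⟨g, hg, hgab⟩ := mk_eq_mk.1 (show mk G a = mk G b from hab)
  have h1 := h g hg a (hVU ha) (by rw [hgab]; exact hVU hb)
  subst h1
  exact Subtype.ext hgab

/-- The complex structure of the quotient `X / G`: the charts are the local inverses of the
projection `X → X / G` followed by the charts of `X`. -/
instance [IsCoveringAction G] : ChartedSpace ℂ (OrbitSpace G) where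
  atlas := {c | ∃ e : OpenPartialHomeomorph X (OrbitSpace G), mk G = e ∧
    ∃ c₀ ∈ atlas ℂ X, c = e.symm ≫ₕ c₀}
  chartAt y := ((isLocalHomeomorph_mk G y.out).choose).symm ≫ₕ chartAt ℂ y.out
  mem_chart_source y := by
    have h := (isLocalHomeomorph_mk G y.out).choose_spec
    have hy : mk G y.out = y := Quotient.out_eq y
    set e := (isLocalHomeomorph_mk G y.out).choose
    have h1 : e y.out = y := (congrFun h.2 _).symm.trans hy
    have h2 : e.symm y = y.out := by
      conv_lhs => rw [← h1]
      exact e.left_inv h.1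
    rw [OpenPartialHomeomorph.trans_source]
    refine ⟨?_, ?_⟩
    · have := e.map_source h.1
      rw [h1] at this
      exact this
    · change e.symm y ∈ (chartAt ℂ y.out).source
      rw [h2]
      exact mem_chart_source ℂ _
  chart_mem_atlas y :=
    ⟨_, (isLocalHomeomorph_mk G y.out).choose_spec.2, _, chart_mem_atlas ℂ _, rfl⟩

instance [IsManifold 𝓘(ℂ) ω X] [hG : IsCoveringAction G] :
    IsManifold 𝓘(ℂ) ω (OrbitSpace G) := by
  have : IsManifold 𝓘(ℂ) 1 X := IsManifold.of_le (n := ω) le_top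
  apply isManifold_of_contDiffOn
  rintro _ _ ⟨e, he, c, hc, rfl⟩ ⟨e', he', c', hc', rfl⟩
  have hopen : IsOpen ((e.symm ≫ₕ c).symm ≫ₕ (e'.symm ≫ₕ c')).source :=
    OpenPartialHomeomorph.open_source _
  simp only [modelWithCornersSelf_coe, modelWithCornersSelf_coe_symm, Set.range_id,
    Set.inter_univ, Set.preimage_id, Function.comp_id, Function.id_comp]
  refine DifferentiableOn.contDiffOn ?_ hopen
  intro w hw
  refine DifferentiableAt.differentiableWithinAt ?_
  simp only [OpenPartialHomeomorph.trans_source, OpenPartialHomeomorph.symm_source,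
    Set.mem_inter_iff, Set.mem_preimage, OpenPartialHomeomorph.coe_trans, Function.comp_apply,
    OpenPartialHomeomorph.trans_symm_eq_symm_trans_symm, OpenPartialHomeomorph.symm_symm] at hw
  obtain ⟨⟨hw1, hw2⟩, hw3, hw4⟩ := hw
  set x := c.symm w with hx
  have hmk : mk G x = mk G (e'.symm (e x)) := by
    rw [he', e'.right_inv hw3, ← he', he]
  obtain ⟨g, hg, hgx⟩ := mk_eq_mk.1 hmk
  have hdg := (hG.le_autGroup hg).1
  have hlocal : ∀ᶠ y in 𝓝 x, e'.symm (e y) = g y := by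
    have hsrc : e'.source ∈ 𝓝 (g x) :=
      e'.open_source.mem_nhds (by rw [hgx]; exact e'.map_target hw3)
    filter_upwards [g.continuous.continuousAt hsrc] with y hy
    have : e y = e' (g y) := by rw [← he, ← he', mk_apply hg]
    rw [this]
    exact e'.left_inv hy
  have hcont : ContinuousAt c.symm w := c.symm.continuousAt hw1
  have heq : (((e.symm ≫ₕ c).symm ≫ₕ (e'.symm ≫ₕ c')) : ℂ → ℂ) =ᶠ[𝓝 w]
      (c' ∘ g ∘ c.symm) := by
    filter_upwards [hcont.eventually hlocal] with v hv
    simp only [OpenPartialHomeomorph.coe_trans, Function.comp_apply,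
      OpenPartialHomeomorph.trans_symm_eq_symm_trans_symm, OpenPartialHomeomorph.symm_symm]
    rw [hv]
  refine DifferentiableAt.congr_of_eventuallyEq ?_ heq
  rw [← mdifferentiableAt_iff_differentiableAt]
  have h1 : MDifferentiableAt 𝓘(ℂ) 𝓘(ℂ) c.symm w :=
    mdifferentiableAt_atlas_symm hc hw1
  have h2 : MDifferentiableAt 𝓘(ℂ) 𝓘(ℂ) g (c.symm w) := hdg _
  have h3 : MDifferentiableAt 𝓘(ℂ) 𝓘(ℂ) c' (g (c.symm w)) :=
    mdifferentiableAt_atlas hc' (by rw [← hx, hgx]; exact hw4)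
  exact h3.comp w (h2.comp w h1)

instance [ConnectedSpace X] : ConnectedSpace (OrbitSpace G) :=
  inferInstanceAs (ConnectedSpace (Quotient (orbitSetoid G)))

end OrbitSpace

end Surfaces

section Groups

/-- The subgroup `Γ_k` generated by the commutators of `Γ` and, if `k ≠ ∞`, by the `k`-th powers
of the elements of `Γ`. -/
def homologySubgroup {A : Type*} [Group A] (Γ : Subgroup A) (k : ℕ∞) : Subgroup A :=
  ⁅Γ, Γ⁆ ⊔ Subgroup.closure {y | ∃ n : ℕ, (n : ℕ∞) = k ∧ ∃ x ∈ Γ, y = x ^ n}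

theorem homologySubgroup_le {A : Type*} [Group A] (Γ : Subgroup A) (k : ℕ∞) :
    homologySubgroup Γ k ≤ Γ := by
  refine sup_le (Subgroup.commutator_le.2 fun a ha b hb => ?_) ?_
  · exact mul_mem (mul_mem (mul_mem ha hb) (inv_mem ha)) (inv_mem hb)
  · rw [Subgroup.closure_le]
    rintro _ ⟨n, -, x, hx, rfl⟩
    exact pow_mem hx n

/-- A presentation of the group `H` with generators indexed by `J` and relators indexed
by `I`. -/
structure GroupPresentation (H : Type*) [Group H] (J I : Type*) where
  gen : J → H
  rel : I → FreeGroup J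
  lift_surjective : Function.Surjective (FreeGroup.lift gen)
  ker_lift : (FreeGroup.lift gen).ker = Subgroup.normalClosure (Set.range rel)

/-- `ℤ_k`, where `ℤ_∞ = ℤ`. -/
abbrev ZModInf (k : ℕ∞) : Type := ZMod k.toNat

end Groups

section ClosedSurfaces

/-- The point with parameter `s` on the boundary of the closed unit disc, seen as a polygon with
`4g` sides; the vertices are the points whose parameters are integers. -/
def polygonPoint (g : ℕ) (s : ℝ) : Metric.closedBall (0 : ℂ) 1 :=
  ⟨Complex.exp (((2 * Real.pi * s / (4 * g) : ℝ) : ℂ) * Complex.I), by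
    rw [mem_closedBall_zero_iff, Complex.norm_exp_ofReal_mul_I]⟩

/-- The side identifications of the `4g`-gon with boundary word
`a₁ b₁ a₁⁻¹ b₁⁻¹ ⋯ a_g b_g a_g⁻¹ b_g⁻¹`. -/
inductive PolygonRel (g : ℕ) :
    Metric.closedBall (0 : ℂ) 1 → Metric.closedBall (0 : ℂ) 1 → Prop
  | a (j : Fin g) (t : ℝ) (ht : t ∈ Set.Icc (0 : ℝ) 1) :
      PolygonRel g (polygonPoint g (4 * (j : ℝ) + t)) (polygonPoint g (4 * (j : ℝ) + 3 - t))
  | b (j : Fin g) (t : ℝ) (ht : t ∈ Set.Icc (0 : ℝ) 1) :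
      PolygonRel g (polygonPoint g (4 * (j : ℝ) + 1 + t)) (polygonPoint g (4 * (j : ℝ) + 4 - t))

/-- The closed orientable surface of genus `g ≥ 1`: the `4g`-gon with its sides identified. -/
def ClosedSurface (g : ℕ) : Type := Quot (PolygonRel g)

instance (g : ℕ) : TopologicalSpace (ClosedSurface g) :=
  inferInstanceAs (TopologicalSpace (Quot (PolygonRel g)))

end ClosedSurfaces

/-- The surface `S` is non-exceptional: its fundamental group is not abelian. -/
def IsNonexceptional (S : Type*) [TopologicalSpace S] : Prop :=
  ∃ (x : S) (a b : FundamentalGroup S x), a * b ≠ b * a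

/-- A uniformization of the Riemann surface `S`: a holomorphic universal covering map from the
hyperbolic plane onto `S`. It identifies `S` with the quotient of the hyperbolic plane by its
deck group. -/
structure Uniformization (S : Type*) [TopologicalSpace S] [ChartedSpace ℂ S] where
  proj : ℍ → S
  mdifferentiable : MDifferentiable 𝓘(ℂ) 𝓘(ℂ) proj
  isCoveringMap : IsCoveringMap proj
  surjective : Function.Surjective proj

namespace Uniformization

variable {S : Type*} [TopologicalSpace S] [ChartedSpace ℂ S] (u : Uniformization S) (k : ℕ∞)

/-- The torsion-free Fuchsian group `Γ` such that `S = ℍ / Γ`. -/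
def fuchsianGroup : Subgroup (ℍ ≃ₜ ℍ) := deckGroup u.proj

instance isCoveringAction_homologySubgroup :
    IsCoveringAction (homologySubgroup u.fuchsianGroup k) :=
  isCoveringAction_of_le_deckGroup
    (isLocallyInjective_iff_nhds.1 u.isCoveringMap.isLocalHomeomorph.isLocallyInjective)
    (homologySubgroup_le _ k)

/-- The `k`-homology cover `ℍ / Γ_k` of `S`. -/
abbrev Cover : Type := OrbitSpace (homologySubgroup u.fuchsianGroup k)

instance [T2Space S] : T2Space (u.Cover k) :=
  have : LocallyConnectedSpace S := ChartedSpace.locallyConnectedSpace ℂ S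
  OrbitSpace.t2Space_of_isCoveringMap u.isCoveringMap
    fun _ hg => (homologySubgroup_le _ k hg).2

/-- The covering map `π_k` from the `k`-homology cover onto `S`. -/
def coverProj : u.Cover k → S :=
  OrbitSpace.desc u.proj fun _ hg => (homologySubgroup_le _ k hg).2

theorem coverProj_mk (z : ℍ) : u.coverProj k (OrbitSpace.mk _ z) = u.proj z := rfl

theorem coverProj_surjective : Function.Surjective (u.coverProj k) := fun s =>
  (u.surjective s).elim fun z hz => ⟨OrbitSpace.mk _ z, hz⟩

/-- The group `M_k`: the deck group of `π_k`. -/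
abbrev deck : Subgroup (u.Cover k ≃ₜ u.Cover k) := deckGroup (u.coverProj k)

theorem coverProj_locallyInjective (y : u.Cover k) :
    ∃ U ∈ 𝓝 y, Set.InjOn (u.coverProj k) U := by
  obtain ⟨z, rfl⟩ := OrbitSpace.mk_surjective y
  obtain ⟨U, hU, hzU, hinj⟩ := u.isCoveringMap.isLocalHomeomorph.isLocallyInjective z
  refine ⟨OrbitSpace.mk _ '' U, (OrbitSpace.isOpenMap_mk U hU).mem_nhds ⟨z, hzU, rfl⟩, ?_⟩
  rintro _ ⟨a, ha, rfl⟩ _ ⟨b, hb, rfl⟩ hab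
  rw [hinj ha hb hab]

variable (L : Subgroup (autGroup S))

/-- The group of the conformal automorphisms of the `k`-homology cover which are lifts,
under `π_k`, of elements of `L`. -/
def liftGroup : Subgroup (u.Cover k ≃ₜ u.Cover k) where
  carrier := {ψ | ψ ∈ autGroup (u.Cover k) ∧
    ∃ φ : L, ∀ x, u.coverProj k (ψ x) = (φ : autGroup S).1 (u.coverProj k x)}
  mul_mem' := by
    rintro a b ⟨ha, φ, hφ⟩ ⟨hb, φ', hφ'⟩
    refine ⟨mul_mem ha hb, φ * φ', fun x => ?_⟩
    exact (hφ (b x)).trans (congrArg _ (hφ' x))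
  one_mem' := ⟨one_mem _, 1, fun _ => rfl⟩
  inv_mem' := by
    rintro a ⟨ha, φ, hφ⟩
    refine ⟨inv_mem ha, φ⁻¹, fun x => ?_⟩
    have h := hφ (a.symm x)
    rw [a.apply_symm_apply] at h
    rw [h]
    exact ((φ : autGroup S).1.symm_apply_apply _).symm

theorem deck_le_liftGroup : u.deck k ≤ u.liftGroup k L :=
  fun _ h => ⟨h.1, 1, h.2⟩

theorem eq_of_lifts {ψ : u.Cover k → u.Cover k} {φ φ' : L}
    (h : ∀ x, u.coverProj k (ψ x) = (φ : autGroup S).1 (u.coverProj k x))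
    (h' : ∀ x, u.coverProj k (ψ x) = (φ' : autGroup S).1 (u.coverProj k x)) : φ = φ' := by
  apply Subtype.ext
  apply Subtype.ext
  ext s
  obtain ⟨x, rfl⟩ := u.coverProj_surjective k s
  exact (h x).symm.trans (h' x)

/-- The homomorphism `θ_k`, which sends a lift `ψ` of `φ ∈ L` to `φ`; that is,
`π_k ∘ ψ = θ_k(ψ) ∘ π_k`. -/
def theta : u.liftGroup k L →* L where
  toFun ψ := ψ.2.2.choose
  map_one' := u.eq_of_lifts k L (Subgroup.one_mem (u.liftGroup k L)).2.choose_spec fun _ => rfl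
  map_mul' a b := u.eq_of_lifts k L (a * b).2.2.choose_spec fun x =>
    (a.2.2.choose_spec (b.1 x)).trans (congrArg _ (b.2.2.choose_spec x))

theorem theta_spec (ψ : u.liftGroup k L) (x : u.Cover k) :
    u.coverProj k (ψ.1 x) = (u.theta k L ψ : autGroup S).1 (u.coverProj k x) :=
  ψ.2.2.choose_spec x

theorem coe_mem_deck {ψ : u.liftGroup k L} (h : u.theta k L ψ = 1) : ψ.1 ∈ u.deck k :=
  ⟨ψ.2.1, fun x => by rw [u.theta_spec k L ψ x, h]; rfl⟩

variable {L} {J I : Type*} (P : GroupPresentation L J I)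

/-- A choice of lifts `ψ_j`, under `θ_k`, of the generators `φ_j` of a presentation of `L`. -/
structure GeneratorLifts where
  lift : J → u.liftGroup k L
  theta_lift : ∀ j, u.theta k L (lift j) = P.gen j

namespace GeneratorLifts

variable {u k P} (c : u.GeneratorLifts k P)

/-- The value `m_i = R_i({ψ_j})` of the `i`-th relator. -/
def relatorValue (i : I) : u.liftGroup k L := FreeGroup.lift c.lift (P.rel i)

theorem theta_relatorValue (i : I) : u.theta k L (c.relatorValue i) = 1 := by
  have h : (u.theta k L).comp (FreeGroup.lift c.lift) = FreeGroup.lift P.gen := by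
    ext j
    simp [c.theta_lift]
  have h1 : P.rel i ∈ (FreeGroup.lift P.gen).ker := by
    rw [P.ker_lift]
    exact Subgroup.subset_normalClosure ⟨i, rfl⟩
  rw [← h] at h1
  exact h1

/-- The smallest subgroup of `M_k` which contains all the `m_i` and is invariant under
conjugation by the lifts of the elements of `L`. -/
def relatorSubgroup : Subgroup (u.Cover k ≃ₜ u.Cover k) :=
  sInf {N | N ≤ u.deck k ∧ (∀ ψ ∈ u.liftGroup k L, ∀ n ∈ N, ψ * n * ψ⁻¹ ∈ N) ∧
    ∀ i, (c.relatorValue i : u.Cover k ≃ₜ u.Cover k) ∈ N}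

theorem relatorSubgroup_le_deck : c.relatorSubgroup ≤ u.deck k := by
  refine sInf_le ⟨le_rfl, fun ψ hψ n hn => ?_, fun i => u.coe_mem_deck k L
    (c.theta_relatorValue i)⟩
  have h : u.theta k L (⟨ψ, hψ⟩ * ⟨n, u.deck_le_liftGroup k L hn⟩ * ⟨ψ, hψ⟩⁻¹) = 1 := by
    have hn1 : u.theta k L ⟨n, u.deck_le_liftGroup k L hn⟩ = 1 :=
      u.eq_of_lifts k L (u.theta_spec k L _) hn.2
    rw [map_mul, map_mul, hn1, map_inv, mul_one, mul_inv_cancel]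
  exact u.coe_mem_deck k L h

instance : (c.relatorSubgroup.subgroupOf (u.liftGroup k L)).Normal where
  conj_mem n hn ψ := by
    rw [Subgroup.mem_subgroupOf] at hn ⊢
    rw [relatorSubgroup, Subgroup.mem_sInf] at hn ⊢
    exact fun N hN => hN.2.1 ψ ψ.2 n (hn N hN)

instance [T2Space S] : IsCoveringAction c.relatorSubgroup :=
  isCoveringAction_of_le_deckGroup (u.coverProj_locallyInjective k) c.relatorSubgroup_le_deck

/-- The Riemann surface `W`: the quotient of the `k`-homology cover by the subgroup of `M_k`
determined by the relator values. -/
abbrev W : Type := OrbitSpace c.relatorSubgroup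

/-- The group `𝒢`: the quotient of the group of lifts by the subgroup of `M_k` determined by the
relator values. -/
abbrev InducedGroup : Type := u.liftGroup k L ⧸ c.relatorSubgroup.subgroupOf (u.liftGroup k L)

/-- The projection onto `𝒢`. -/
def toQuotient : u.liftGroup k L →* c.InducedGroup := QuotientGroup.mk' _

/-- The subgroup `L̂` of `𝒢` induced by the group generated by the lifts `ψ_j`. -/
def hatGroup : Subgroup c.InducedGroup :=
  (Subgroup.closure (Set.range c.lift)).map c.toQuotient

end GeneratorLifts

end Uniformization

end HomologyCover

/-! Trivial relator values mean that `φ_j ↦ ψ_j` respects the relations of `L`, so by von Dyck's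
argument it extends to a homomorphism `s : L → liftGroup`. This is a section of `θ_k` with image
`⟨ψ_j⟩` (`exists_section`). Since `ker θ_k = M_k` (`ker_theta`), the group of lifts is a split
extension, which gives the complement and the semidirect product. The relator subgroup is trivial
because `⊥` already satisfies its defining conditions, so both quotients change nothing.

The real work is `M_k ≅ ℤ_k^{2g}` for closed surfaces (`nonempty_deck_mulEquiv`). Lifting of maps to
`ℍ` shows that `Γ` acts simply transitively on fibres, whence `M_k ≅ Γ / Γ_k` (`ker_toDeck`,
`toDeck_surjective`). To compute this quotient, lift the `4g`-gon to `ℍ`. Its `2g` side pairings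
generate `Γ`, by a connectedness argument (`fuchsianGroup_le_of_lift`). Explicit functions on the
polygon, well defined on `S` modulo `ℤ`, have period homomorphisms `Γ → ℤ` dual to the side pairings
(`exists_dual_hom`). Generators with a dual family force `Γ / Γ_k` to be free over `ℤ_k`
(`nonempty_mulEquiv_of_dual`); no presentation of `Γ` is needed. -/

namespace HomologyCover

/-! ### Split extensions and complements. -/

section SplitExtensions

variable {N E G : Type*} [Group N] [Group E] [Group G]

/-- A group with a split epimorphism is the semidirect product of the kernel and the image. -/
theorem exists_mulEquiv_semidirectProduct (ι : N →* E) (hι : Function.Injective ι) (θ : E →* G)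
    (hker : ι.range = θ.ker) (s : G →* E) (hs : ∀ x, θ (s x) = x) :
    ∃ (α : G →* MulAut N) (e : E ≃* N ⋊[α] G),
      (∀ n, e (ι n) = SemidirectProduct.inl n) ∧ (∀ y, (e y).right = θ y) ∧
      ∀ x, e (s x) = SemidirectProduct.inr x := by
  let X : GroupExtension N E G :=
    { inl := ι
      inl_injective := hι
      range_inl_eq_ker_rightHom := hker
      rightHom := θ
      rightHom_surjective := fun x => ⟨s x, hs x⟩ }
  let σ : X.Splitting := ⟨s, hs⟩
  have hinl : ∀ n, σ.semidirectProductMulEquiv (SemidirectProduct.inl n) = ι n :=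
    σ.semidirectProductToGroupExtensionEquiv.map_inl
  have hinr : ∀ x, σ.semidirectProductMulEquiv (SemidirectProduct.inr x) = s x := fun x => by
    change ι 1 * s x = s x
    rw [map_one, one_mul]
  refine ⟨σ.conjAct, σ.semidirectProductMulEquiv.symm, fun n => ?_, fun y => ?_, fun x => ?_⟩
  · rw [MulEquiv.symm_apply_eq, hinl]
  · exact σ.semidirectProductToGroupExtensionEquiv.symm.rightHom_map y
  · rw [MulEquiv.symm_apply_eq, hinr]

theorem isComplement'_range_of_section (θ : E →* G) (s : G →* E) (hs : ∀ x, θ (s x) = x) :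
    Subgroup.IsComplement' θ.ker s.range := by
  refine Subgroup.isComplement'_of_disjoint_and_mul_eq_univ ?_ ?_
  · rw [Subgroup.disjoint_def]
    rintro _ hx ⟨y, rfl⟩
    rw [MonoidHom.mem_ker, hs] at hx
    rw [hx, map_one]
  · refine Set.eq_univ_of_forall fun x => Set.mem_mul.2
      ⟨x * (s (θ x))⁻¹, ?_, s (θ x), ⟨_, rfl⟩, inv_mul_cancel_right _ _⟩
    change θ _ = 1
    rw [map_mul, map_inv, hs, mul_inv_cancel]

end SplitExtensions

/-! ### The quotient `Γ / Γ_k` from generators with a dual family. -/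

section DualBasis

variable {A M Y : Type*} [Group A] [Group M]

theorem zpow_mem_homologySubgroup {Γ : Subgroup A} {k : ℕ∞} {x : A} (hx : x ∈ Γ) {n : ℤ}
    (hn : (k.toNat : ℤ) ∣ n) : x ^ n ∈ homologySubgroup Γ k := by
  obtain ⟨m, rfl⟩ := hn
  induction k with
  -- Here `toNat ⊤ = 0`, so the exponent is `0`; the same convention makes `ZModInf ⊤ = ZMod 0 = ℤ`.
  | top => simp
  | coe k =>
    rw [ENat.toNat_natCast, zpow_mul, zpow_natCast]
    have h : x ^ k ∈ homologySubgroup Γ k :=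
      Subgroup.mem_sup_right (Subgroup.subset_closure ⟨k, rfl, x, hx, rfl⟩)
    exact zpow_mem h m

/-- A homomorphism from `Γ` to a commutative group of exponent dividing `k` kills `Γ_k`. -/
theorem homologySubgroup_subgroupOf_le_ker {C : Type*} [CommGroup C] {Γ : Subgroup A} {k : ℕ∞}
    (f : Γ →* C) (hf : ∀ x, f x ^ k.toNat = 1) : (homologySubgroup Γ k).subgroupOf Γ ≤ f.ker := by
  have h : homologySubgroup Γ k ≤ f.ker.map Γ.subtype := by
    refine sup_le (Subgroup.commutator_le.2 fun a ha b hb => ?_) ?_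
    · let a' : Γ := ⟨a, ha⟩
      let b' : Γ := ⟨b, hb⟩
      refine ⟨a' * b' * a'⁻¹ * b'⁻¹, ?_, rfl⟩
      change f _ = 1
      simp only [map_mul, map_inv]
      rw [mul_inv_eq_one, mul_inv_eq_iff_eq_mul, mul_comm]
    · rw [Subgroup.closure_le]
      rintro _ ⟨n, rfl, x, hx, rfl⟩
      exact ⟨⟨x, hx⟩ ^ n, (map_pow f _ n).trans (hf _), rfl⟩
  intro x hx
  obtain ⟨y, hy, hyx⟩ := h hx
  rwa [← Subtype.ext hyx]

/-- Since `x y x⁻¹ = [x, y] y`, any subgroup between `[Γ, Γ]` and `Γ` is normal in `Γ`. -/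
theorem conj_mem_homologySubgroup {A : Type*} [Group A] {Γ : Subgroup A} {k : ℕ∞} {x y : A}
    (hx : x ∈ Γ) (hy : y ∈ homologySubgroup Γ k) : x * y * x⁻¹ ∈ homologySubgroup Γ k := by
  have h : x * y * x⁻¹ * y⁻¹ ∈ homologySubgroup Γ k :=
    Subgroup.mem_sup_left (Subgroup.commutator_mem_commutator hx (homologySubgroup_le Γ k hy))
  simpa using mul_mem h hy

/-- If `Γ` is generated by a finite family which has a dual family of homomorphisms to `ℤ`, then
`Γ / Γ_k` is a free module over `ℤ_k`. -/
theorem nonempty_mulEquiv_of_dual [Fintype Y] [DecidableEq Y] {Γ : Subgroup A} {k : ℕ∞}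
    (b : Y → Γ) (hb : Subgroup.closure (Set.range b) = ⊤) (χ : Y → Γ →* Multiplicative ℤ)
    (hχ : ∀ x y, χ x (b y) = Multiplicative.ofAdd (if x = y then 1 else 0)) (ρ : Γ →* M)
    (hρ : Function.Surjective ρ) (hker : ρ.ker = (homologySubgroup Γ k).subgroupOf Γ) :
    Nonempty (M ≃* Multiplicative (Y → ZModInf k)) := by
  have hcomm : ∀ a b : M, a * b = b * a := by
    intro a b
    obtain ⟨x, rfl⟩ := hρ a
    obtain ⟨y, rfl⟩ := hρ b
    have h : x * y * x⁻¹ * y⁻¹ ∈ ρ.ker := by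
      rw [hker]
      exact Subgroup.mem_sup_left (Subgroup.commutator_mem_commutator x.2 y.2)
    rwa [MonoidHom.mem_ker, map_mul, map_mul, map_mul, map_inv, map_inv, mul_inv_eq_one,
      mul_inv_eq_iff_eq_mul] at h
  let _ : CommGroup M := { (inferInstance : Group M) with mul_comm := hcomm }
  let Φ : Γ →* Multiplicative (Y → ZModInf k) :=
    { toFun := fun x => Multiplicative.ofAdd fun y => ((χ y x).toAdd : ZModInf k)
      map_one' := by simp; rfl
      map_mul' := fun x x' => by
        rw [← ofAdd_add]
        congr 1
        ext y
        simp }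
  have hΦ : ∀ x, Φ x = Multiplicative.ofAdd fun y => ((χ y x).toAdd : ZModInf k) := fun _ => rfl
  -- As `M` is commutative, the right side is a homomorphism in `x`; duality makes it agree with `ρ`
  -- on the generators.
  have hexp : ∀ x, ρ x = ∏ y, ρ (b y) ^ (χ y x).toAdd := by
    let Ψ : Γ →* M :=
      { toFun := fun x => ∏ y, ρ (b y) ^ (χ y x).toAdd
        map_one' := by simp
        map_mul' := fun x x' => by simp [zpow_add, Finset.prod_mul_distrib] }
    have : ρ = Ψ := by
      refine MonoidHom.eq_of_eqOn_dense hb ?_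
      rintro _ ⟨y, rfl⟩
      change ρ (b y) = ∏ z, ρ (b z) ^ (χ z (b y)).toAdd
      rw [Finset.prod_eq_single y (fun z _ hz => by simp [hχ, hz]) (by simp)]
      simp [hχ]
    exact fun x => DFunLike.congr_fun this x
  -- If `k` divides every coordinate `χ y x`, each factor in `hexp` is trivial. Conversely, `Φ`
  -- takes values in a commutative group of exponent dividing `k`.
  have hΦker : Φ.ker = ρ.ker := by
    refine le_antisymm (fun x hx => ?_) ?_
    · rw [MonoidHom.mem_ker, hΦ, ofAdd_eq_one] at hx
      rw [MonoidHom.mem_ker, hexp]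
      refine Finset.prod_eq_one fun y _ => ?_
      rw [← map_zpow, ← MonoidHom.mem_ker, hker, Subgroup.mem_subgroupOf]
      exact zpow_mem_homologySubgroup (b y).2
        ((ZMod.intCast_zmod_eq_zero_iff_dvd _ _).1 (congrFun hx y))
    · rw [hker]
      refine homologySubgroup_subgroupOf_le_ker Φ fun x => ?_
      rw [hΦ, ← ofAdd_nsmul, ofAdd_eq_one]
      ext y
      simp [ZModInf]
  have hΦsurj : Function.Surjective Φ := by
    intro v
    choose n hn using fun y => ZMod.intCast_surjective (v.toAdd y)
    -- `Γ` need not be commutative, so the preimage is an ordered product.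
    refine ⟨(Finset.univ.toList.map fun y => b y ^ n y).prod, ?_⟩
    rw [map_list_prod, List.map_map, Finset.prod_map_toList]
    refine Multiplicative.toAdd.injective (funext fun z => ?_)
    rw [toAdd_prod, Finset.sum_apply, Finset.sum_eq_single z]
    · simp [hΦ, hχ, hn]
    · intro y _ hy
      simp [hΦ, hχ, hy.symm]
    · simp
  exact ⟨((QuotientGroup.quotientKerEquivOfSurjective ρ hρ).symm.trans
    (QuotientGroup.quotientMulEquivOfEq hΦker.symm)).trans
    (QuotientGroup.quotientKerEquivOfSurjective Φ hΦsurj)⟩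

end DualBasis


/-! ### Continuous lifts of holomorphic maps are holomorphic. -/

section Holomorphy

/-- A continuous locally injective function is holomorphic if its composition with a non-constant
holomorphic function is. -/
theorem differentiableAt_of_comp {f h : ℂ → ℂ} {z : ℂ} (hf : ∀ᶠ x in 𝓝 z, ContinuousAt f x)
    (hinj : ∀ᶠ x in 𝓝[≠] z, f x ≠ f z) (hh : AnalyticAt ℂ h (f z))
    (hne : ∀ᶠ w in 𝓝[≠] (f z), h w ≠ h (f z))
    (hg : ∀ᶠ x in 𝓝 z, DifferentiableAt ℂ (h ∘ f) x) : DifferentiableAt ℂ f z := by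
  -- Zeros of `deriv h` are isolated, since otherwise `h` would be constant near `f z`.
  have hderiv : ∀ᶠ w in 𝓝[≠] (f z), deriv h w ≠ 0 := by
    refine hh.deriv.eventually_eq_zero_or_eventually_ne_zero.resolve_left fun h0 => ?_
    obtain ⟨r, hr, hball⟩ := Metric.eventually_nhds_iff_ball.1 (h0.and hh.eventually_analyticAt)
    have hconst : ∀ w ∈ Metric.ball (f z) r, h w = h (f z) := fun w hw =>
      Metric.isOpen_ball.is_const_of_deriv_eq_zero (convex_ball _ _).isPreconnected
        (fun w hw => (hball w hw).2.differentiableAt.differentiableWithinAt)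
        (fun w hw => (hball w hw).1) hw (Metric.mem_ball_self hr)
    have : ∀ᶠ w in 𝓝[≠] (f z), h w = h (f z) :=
      nhdsWithin_le_nhds (Filter.mem_of_superset (Metric.ball_mem_nhds _ hr) hconst)
    obtain ⟨w, hw, hw'⟩ := (this.and hne).exists
    exact hw' hw
  have hfz : ContinuousAt f z := hf.self_of_nhds
  have hlim : Filter.Tendsto f (𝓝[≠] z) (𝓝[≠] (f z)) :=
    tendsto_nhdsWithin_iff.2 ⟨hfz.tendsto.mono_left nhdsWithin_le_nhds, hinj⟩
  -- Away from `z`, `f` is a local inverse of `h` composed with `h ∘ f`; the singularity at `z` is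
  -- removable by continuity.
  refine (Complex.analyticAt_of_differentiable_on_punctured_nhds_of_continuousAt ?_
    hfz).differentiableAt
  filter_upwards [hlim.eventually hderiv, nhdsWithin_le_nhds hf, nhdsWithin_le_nhds hg,
    nhdsWithin_le_nhds (hfz.eventually hh.eventually_analyticAt)] with x hx hfx hgx hhx
  have hs := hhx.hasStrictDerivAt
  have hinv := (hs.to_localInverse hx).hasDerivAt.differentiableAt
  have heq : f =ᶠ[𝓝 x] hs.localInverse h _ _ hx ∘ (h ∘ f) := by
    filter_upwards [hfx.eventually (HasStrictDerivAt.eventually_left_inverse hs hx)] with y hy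
    exact hy.symm
  exact (hinv.comp x hgx).congr_of_eventuallyEq heq

variable {X Y Z : Type*} [TopologicalSpace X] [ChartedSpace ℂ X] [IsManifold 𝓘(ℂ) ω X]
  [TopologicalSpace Y] [ChartedSpace ℂ Y] [IsManifold 𝓘(ℂ) ω Y]
  [TopologicalSpace Z] [ChartedSpace ℂ Z] [IsManifold 𝓘(ℂ) ω Z]

/-- A continuous injective lift of a holomorphic map under a locally injective holomorphic map is
holomorphic. -/
theorem mdifferentiable_of_comp {p : Y → Z} (hp : MDifferentiable 𝓘(ℂ) 𝓘(ℂ) p)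
    (hpinj : ∀ y, ∃ U ∈ 𝓝 y, Set.InjOn p U) {f : X → Y} (hf : Continuous f)
    (hfinj : Function.Injective f) (hpf : MDifferentiable 𝓘(ℂ) 𝓘(ℂ) (p ∘ f)) :
    MDifferentiable 𝓘(ℂ) 𝓘(ℂ) f := by
  have : IsManifold 𝓘(ℂ) 1 X := IsManifold.of_le (n := ω) le_top
  have : IsManifold 𝓘(ℂ) 1 Y := IsManifold.of_le (n := ω) le_top
  have : IsManifold 𝓘(ℂ) 1 Z := IsManifold.of_le (n := ω) le_top
  intro x
  let a := chartAt ℂ x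
  let b := chartAt ℂ (f x)
  let d := chartAt ℂ (p (f x))
  have hax : x ∈ a.source := mem_chart_source ℂ x
  have hbx : f x ∈ b.source := mem_chart_source ℂ (f x)
  have hdx : p (f x) ∈ d.source := mem_chart_source ℂ (p (f x))
  have hax' : a x ∈ a.target := a.map_source hax
  have hbx' : b (f x) ∈ b.target := b.map_source hbx
  have hainv : a.symm (a x) = x := a.left_inv hax
  have hbinv : b.symm (b (f x)) = f x := b.left_inv hbx
  have hatend : Filter.Tendsto a.symm (𝓝 (a x)) (𝓝 x) := by
    simpa only [hainv] using (a.continuousAt_symm hax').tendsto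
  have hbtend : Filter.Tendsto b.symm (𝓝 (b (f x))) (𝓝 (f x)) := by
    simpa only [hbinv] using (b.continuousAt_symm hbx').tendsto
  let F : ℂ → ℂ := b ∘ f ∘ a.symm
  let H : ℂ → ℂ := d ∘ p ∘ b.symm
  have hFx : F (a x) = b (f x) := by simp only [F, Function.comp_apply, hainv]
  have hnear : ∀ᶠ w in 𝓝 (a x), w ∈ a.target ∧ f (a.symm w) ∈ b.source ∧
      p (f (a.symm w)) ∈ d.source :=
    Filter.Eventually.and (a.open_target.mem_nhds hax')
      ((hatend.eventually (hf.continuousAt (b.open_source.mem_nhds hbx))).and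
        (hatend.eventually ((hp.continuous.comp hf).continuousAt (d.open_source.mem_nhds hdx))))
  have hH : ∀ᶠ w in 𝓝 (b (f x)), DifferentiableAt ℂ H w := by
    filter_upwards [b.open_target.mem_nhds hbx',
      hbtend.eventually (hp.continuous.continuousAt (d.open_source.mem_nhds hdx))] with w hw hw'
    rw [← mdifferentiableAt_iff_differentiableAt]
    exact (mdifferentiableAt_atlas (chart_mem_atlas ℂ _) hw').comp w
      ((hp _).comp w (mdifferentiableAt_atlas_symm (chart_mem_atlas ℂ _) hw))
  have hdiff : DifferentiableAt ℂ F (a x) := by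
    refine differentiableAt_of_comp (h := H) ?_ ?_ ?_ ?_ ?_
    · filter_upwards [hnear] with w hw
      have h1 : ContinuousAt (f ∘ a.symm) w := hf.continuousAt.comp (a.continuousAt_symm hw.1)
      exact ContinuousAt.comp (f := f ∘ a.symm) (b.continuousAt hw.2.1) h1
    · rw [eventually_nhdsWithin_iff]
      filter_upwards [hnear] with w hw hwx hF
      rw [hFx] at hF
      have h1 := hfinj (b.injOn hw.2.1 hbx hF)
      exact hwx (by rw [Set.mem_singleton_iff, ← h1, a.right_inv hw.1])
    · rw [hFx]
      exact Complex.analyticAt_iff_eventually_differentiableAt.2 hH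
    · rw [hFx, eventually_nhdsWithin_iff]
      obtain ⟨U, hU, hinj⟩ := hpinj (f x)
      filter_upwards [b.open_target.mem_nhds hbx', hbtend.eventually hU,
        hbtend.eventually (hp.continuous.continuousAt (d.open_source.mem_nhds hdx))]
        with w hw hwU hwd hwx hHw
      simp only [H, Function.comp_apply, hbinv] at hHw
      have h1 := hinj hwU (mem_of_mem_nhds hU) (d.injOn hwd hdx hHw)
      exact hwx (by rw [Set.mem_singleton_iff, ← h1, b.right_inv hw])
    · filter_upwards [hnear, hnear.eventually_nhds] with w hw hw'
      have heq : H ∘ F =ᶠ[𝓝 w] d ∘ (p ∘ f) ∘ a.symm := by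
        filter_upwards [hw'] with v hv
        simp only [H, F, Function.comp_apply, b.left_inv hv.2.1]
      refine DifferentiableAt.congr_of_eventuallyEq ?_ heq
      rw [← mdifferentiableAt_iff_differentiableAt]
      exact (mdifferentiableAt_atlas (chart_mem_atlas ℂ _) hw.2.2).comp w
        ((hpf _).comp w (mdifferentiableAt_atlas_symm (chart_mem_atlas ℂ _) hw.1))
  have heq : f =ᶠ[𝓝 x] b.symm ∘ F ∘ a := by
    filter_upwards [a.open_source.mem_nhds hax,
      hf.continuousAt (b.open_source.mem_nhds hbx)] with y hy hy'
    simp only [F, Function.comp_apply, a.left_inv hy]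
    exact (b.left_inv hy').symm
  refine MDifferentiableAt.congr_of_eventuallyEq ?_ heq
  have h1 : MDifferentiableAt 𝓘(ℂ) 𝓘(ℂ) a x := mdifferentiableAt_atlas (chart_mem_atlas ℂ _) hax
  have h2 : MDifferentiableAt 𝓘(ℂ) 𝓘(ℂ) F (a x) := hdiff.mdifferentiableAt
  have h3 : MDifferentiableAt 𝓘(ℂ) 𝓘(ℂ) b.symm (F (a x)) := by
    rw [hFx]
    exact mdifferentiableAt_atlas_symm (chart_mem_atlas ℂ _) hbx'
  exact h3.comp x (h2.comp x h1)

end Holomorphy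

/-! ### The complex structure of an orbit space. -/

namespace OrbitSpace

variable {X : Type*} [TopologicalSpace X] [ChartedSpace ℂ X] [IsManifold 𝓘(ℂ) ω X]
  (G : Subgroup (X ≃ₜ X)) [IsCoveringAction G]

/-- Each `e.symm ≫ₕ c` is a chart of the quotient by definition, and read in this chart and `c` the
map `e` is the identity. -/
theorem mdifferentiableAt_of_eq_mk {e : OpenPartialHomeomorph X (OrbitSpace G)} (he : mk G = e)
    {x : X} (hx : x ∈ e.source) :
    MDifferentiableAt 𝓘(ℂ) 𝓘(ℂ) e x ∧ MDifferentiableAt 𝓘(ℂ) 𝓘(ℂ) e.symm (e x) := by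
  have : IsManifold 𝓘(ℂ) 1 X := IsManifold.of_le (n := ω) le_top
  have : IsManifold 𝓘(ℂ) 1 (OrbitSpace G) := IsManifold.of_le (n := ω) le_top
  let c := chartAt ℂ x
  have hcx : x ∈ c.source := mem_chart_source ℂ x
  have hc : c ∈ atlas ℂ X := chart_mem_atlas ℂ x
  have hd : e.symm ≫ₕ c ∈ atlas ℂ (OrbitSpace G) := ⟨e, he, c, hc, rfl⟩
  have hsrc : e x ∈ (e.symm ≫ₕ c).source := by
    rw [OpenPartialHomeomorph.trans_source]
    refine ⟨e.map_source hx, ?_⟩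
    rw [Set.mem_preimage, e.left_inv hx]
    exact hcx
  have hval : (e.symm ≫ₕ c) (e x) = c x := by
    rw [OpenPartialHomeomorph.coe_trans, Function.comp_apply, e.left_inv hx]
  have htgt : c x ∈ (e.symm ≫ₕ c).target := hval ▸ (e.symm ≫ₕ c).map_source hsrc
  constructor
  · have heq : e =ᶠ[𝓝 x] (e.symm ≫ₕ c).symm ∘ c := by
      filter_upwards [c.open_source.mem_nhds hcx] with y hy
      simp only [OpenPartialHomeomorph.trans_symm_eq_symm_trans_symm,
        OpenPartialHomeomorph.symm_symm, OpenPartialHomeomorph.coe_trans, Function.comp_apply,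
        c.left_inv hy]
    exact ((mdifferentiableAt_atlas_symm hd htgt).comp x
      (mdifferentiableAt_atlas hc hcx)).congr_of_eventuallyEq heq
  · have heq : e.symm =ᶠ[𝓝 (e x)] c.symm ∘ (e.symm ≫ₕ c) := by
      have hcont : c.source ∈ 𝓝 (e.symm (e x)) := by
        rw [e.left_inv hx]
        exact c.open_source.mem_nhds hcx
      filter_upwards [e.continuousAt_symm (e.map_source hx) hcont] with y hy
      exact (c.left_inv hy).symm
    have h1 : MDifferentiableAt 𝓘(ℂ) 𝓘(ℂ) c.symm ((e.symm ≫ₕ c) (e x)) := by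
      rw [hval]
      exact mdifferentiableAt_atlas_symm hc (c.map_source hcx)
    exact (h1.comp (e x) (mdifferentiableAt_atlas hd hsrc)).congr_of_eventuallyEq heq

theorem mdifferentiable_mk : MDifferentiable 𝓘(ℂ) 𝓘(ℂ) (mk G) := by
  intro x
  obtain ⟨e, hx, he⟩ := isLocalHomeomorph_mk G x
  rw [he]
  exact (mdifferentiableAt_of_eq_mk G he hx).1

variable {G} {Y : Type*} [TopologicalSpace Y] [ChartedSpace ℂ Y]

/-- A map on an orbit space is holomorphic if it is induced by a holomorphic map. -/
theorem mdifferentiable_of_comp_mk {f : OrbitSpace G → Y}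
    (hf : MDifferentiable 𝓘(ℂ) 𝓘(ℂ) (f ∘ mk G)) : MDifferentiable 𝓘(ℂ) 𝓘(ℂ) f := by
  intro y
  obtain ⟨x, rfl⟩ := mk_surjective y
  obtain ⟨e, hx, he⟩ := isLocalHomeomorph_mk G x
  have heq : f =ᶠ[𝓝 (e x)] (f ∘ mk G) ∘ e.symm := by
    filter_upwards [e.open_target.mem_nhds (e.map_source hx)] with y hy
    simp only [Function.comp_apply, he, e.right_inv hy]
  rw [he]
  exact ((hf _).comp (e x) (mdifferentiableAt_of_eq_mk G he hx).2).congr_of_eventuallyEq heq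

end OrbitSpace


/-! ### Uniqueness of lifts. -/

section Agreement

/-- Two continuous maps with the same composition with a locally injective map are equal if they
agree at a point. -/
theorem eq_of_comp_eq_of_locallyInjective {X Y Z : Type*} [TopologicalSpace X]
    [PreconnectedSpace X] [TopologicalSpace Y] [T2Space Y] {p : Y → Z}
    (hp : ∀ y, ∃ U ∈ 𝓝 y, Set.InjOn p U) {f g : X → Y} (hf : Continuous f) (hg : Continuous g)
    (h : ∀ x, p (f x) = p (g x)) {x : X} (hx : f x = g x) : f = g := by
  have hopen : IsOpen {z | f z = g z} := by
    rw [isOpen_iff_mem_nhds]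
    intro z hz
    obtain ⟨U, hU, hinj⟩ := hp (f z)
    have hU' : U ∈ 𝓝 (g z) := by rwa [← show f z = g z from hz]
    filter_upwards [hf.continuousAt hU, hg.continuousAt hU'] with w hw hw'
    exact hinj hw hw' (h w)
  exact funext (Set.eq_univ_iff_forall.1 (IsClopen.eq_univ ⟨isClosed_eq hf hg, hopen⟩ ⟨x, hx⟩))

end Agreement

/-! ### The deck group of the `k`-homology cover as `Γ / Γ_k`. -/

namespace Uniformization

variable {S : Type*} [TopologicalSpace S] [ChartedSpace ℂ S] (u : Uniformization S) (k : ℕ∞)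

theorem proj_apply {γ : ℍ ≃ₜ ℍ} (hγ : γ ∈ u.fuchsianGroup) (z : ℍ) : u.proj (γ z) = u.proj z :=
  hγ.2 z

theorem proj_locallyInjective (z : ℍ) : ∃ U ∈ 𝓝 z, Set.InjOn u.proj U :=
  isLocallyInjective_iff_nhds.1 u.isCoveringMap.isLocalHomeomorph.isLocallyInjective z

/-- Deck transformations are lifts of `u.proj`, hence determined by one value: `Γ` acts freely. -/
theorem fuchsianGroup_ext {γ γ' : ℍ ≃ₜ ℍ} (hγ : γ ∈ u.fuchsianGroup) (hγ' : γ' ∈ u.fuchsianGroup)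
    {z : ℍ} (hz : γ z = γ' z) : γ = γ' :=
  Homeomorph.ext (congrFun (eq_of_comp_eq_of_locallyInjective u.proj_locallyInjective
    γ.continuous γ'.continuous (fun w => (hγ.2 w).trans (hγ'.2 w).symm) hz))

theorem exists_continuous_lift {A : Type*} [TopologicalSpace A] [SimplyConnectedSpace A]
    [LocallyPathConnectedSpace A] {f : A → S} (hf : Continuous f) {a : A} {z : ℍ}
    (hz : u.proj z = f a) : ∃ F : A → ℍ, Continuous F ∧ F a = z ∧ ∀ x, u.proj (F x) = f x := by
  obtain ⟨F, ⟨hFa, hF⟩, -⟩ :=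
    u.isCoveringMap.existsUnique_continuousMap_lifts ⟨f, hf⟩ a z hz
  exact ⟨F, F.continuous, hFa, congrFun hF⟩

/-- The Fuchsian group acts transitively on the fibres of the uniformization. -/
theorem exists_fuchsianGroup_apply_eq [IsManifold 𝓘(ℂ) ω S] {z w : ℍ}
    (h : u.proj z = u.proj w) : ∃ γ ∈ u.fuchsianGroup, γ z = w := by
  obtain ⟨F, hF, hFz, hpF⟩ := u.exists_continuous_lift u.isCoveringMap.continuous h.symm
  obtain ⟨F', hF', hFw, hpF'⟩ := u.exists_continuous_lift u.isCoveringMap.continuous h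
  -- Both sides lift `u.proj` through itself and fix `z`.
  have h1 : F' ∘ F = id := eq_of_comp_eq_of_locallyInjective u.proj_locallyInjective
    (hF'.comp hF) continuous_id (fun x => (hpF' _).trans (hpF x)) (x := z) (by simp [hFz, hFw])
  have h2 : F ∘ F' = id := eq_of_comp_eq_of_locallyInjective u.proj_locallyInjective
    (hF.comp hF') continuous_id (fun x => (hpF _).trans (hpF' x)) (x := w) (by simp [hFz, hFw])
  let γ : ℍ ≃ₜ ℍ :=
    { toFun := F
      invFun := F'
      left_inv := congrFun h1
      right_inv := congrFun h2
      continuous_toFun := hF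
      continuous_invFun := hF' }
  refine ⟨γ, ⟨⟨?_, ?_⟩, hpF⟩, hFz⟩
  · refine mdifferentiable_of_comp u.mdifferentiable u.proj_locallyInjective γ.continuous
      γ.injective ?_
    rw [show u.proj ∘ γ = u.proj from funext hpF]
    exact u.mdifferentiable
  · refine mdifferentiable_of_comp u.mdifferentiable u.proj_locallyInjective γ.symm.continuous
      γ.symm.injective ?_
    rw [show u.proj ∘ γ.symm = u.proj from funext hpF']
    exact u.mdifferentiable

/-- The map of the `k`-homology cover induced by an element of the Fuchsian group. -/
def deckMap (γ : u.fuchsianGroup) : u.Cover k → u.Cover k :=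
  OrbitSpace.desc (fun z => OrbitSpace.mk _ (γ.1 z)) fun g hg z =>
    -- This element sends `γ (g z)` back to `γ z`; it lies in `Γ_k` by normality.
    OrbitSpace.mk_eq_mk.2 ⟨γ.1 * g⁻¹ * γ.1⁻¹,
      conj_mem_homologySubgroup γ.2 (inv_mem hg), by
        change γ.1 (g.symm (γ.1.symm (γ.1 (g z)))) = γ.1 z
        rw [γ.1.symm_apply_apply, g.symm_apply_apply]⟩

theorem deckMap_mul (γ γ' : u.fuchsianGroup) (x : u.Cover k) :
    u.deckMap k (γ * γ') x = u.deckMap k γ (u.deckMap k γ' x) := by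
  obtain ⟨z, rfl⟩ := OrbitSpace.mk_surjective x
  rfl

theorem deckMap_one (x : u.Cover k) : u.deckMap k 1 x = x := by
  obtain ⟨z, rfl⟩ := OrbitSpace.mk_surjective x
  rfl

theorem continuous_deckMap (γ : u.fuchsianGroup) : Continuous (u.deckMap k γ) :=
  (OrbitSpace.continuous_mk.comp γ.1.continuous).quotient_lift _

theorem mdifferentiable_deckMap (γ : u.fuchsianGroup) :
    MDifferentiable 𝓘(ℂ) 𝓘(ℂ) (u.deckMap k γ) :=
  OrbitSpace.mdifferentiable_of_comp_mk ((OrbitSpace.mdifferentiable_mk _).comp γ.2.1.1)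

/-- The homomorphism from the Fuchsian group onto the deck group of the `k`-homology cover. -/
def toDeck : u.fuchsianGroup →* u.deck k where
  toFun γ :=
    ⟨{ toFun := u.deckMap k γ
       invFun := u.deckMap k γ⁻¹
       left_inv := fun x => by rw [← deckMap_mul, inv_mul_cancel, deckMap_one]
       right_inv := fun x => by rw [← deckMap_mul, mul_inv_cancel, deckMap_one]
       continuous_toFun := u.continuous_deckMap k γ
       continuous_invFun := u.continuous_deckMap k γ⁻¹ },
      ⟨u.mdifferentiable_deckMap k γ, u.mdifferentiable_deckMap k γ⁻¹⟩, fun x => by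
        obtain ⟨z, rfl⟩ := OrbitSpace.mk_surjective x
        exact u.proj_apply γ.2 z⟩
  map_one' := Subtype.ext (Homeomorph.ext (u.deckMap_one k))
  map_mul' γ γ' := Subtype.ext (Homeomorph.ext (u.deckMap_mul k γ γ'))

theorem toDeck_apply_mk (γ : u.fuchsianGroup) (z : ℍ) :
    (u.toDeck k γ).1 (OrbitSpace.mk _ z) = OrbitSpace.mk _ (γ.1 z) := rfl

/-- If `γ` acts trivially below, it agrees at one point with some element of `Γ_k`, and freeness
makes them equal. -/
theorem ker_toDeck :
    (u.toDeck k).ker = (homologySubgroup u.fuchsianGroup k).subgroupOf u.fuchsianGroup := by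
  ext γ
  rw [MonoidHom.mem_ker, Subgroup.mem_subgroupOf]
  constructor
  · intro h
    have h1 := u.toDeck_apply_mk k γ UpperHalfPlane.I
    rw [h] at h1
    obtain ⟨g, hg, hgz⟩ := OrbitSpace.mk_eq_mk.1 h1
    rwa [← u.fuchsianGroup_ext (homologySubgroup_le _ k hg) γ.2 hgz]
  · intro h
    refine Subtype.ext (Homeomorph.ext fun x => ?_)
    obtain ⟨z, rfl⟩ := OrbitSpace.mk_surjective x
    rw [toDeck_apply_mk, OrbitSpace.mk_apply h]
    rfl

/-- Transitivity on fibres supplies a `γ` matching `ψ` at a single point; uniqueness of lifts under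
`coverProj` does the rest. -/
theorem toDeck_surjective [T2Space S] [IsManifold 𝓘(ℂ) ω S] :
    Function.Surjective (u.toDeck k) := by
  intro ψ
  obtain ⟨w, hw⟩ := OrbitSpace.mk_surjective (ψ.1 (OrbitSpace.mk _ UpperHalfPlane.I))
  have hp : u.proj UpperHalfPlane.I = u.proj w := by
    have h := ψ.2.2 (OrbitSpace.mk _ UpperHalfPlane.I)
    rw [← hw] at h
    exact h.symm
  obtain ⟨γ, hγ, hγw⟩ := u.exists_fuchsianGroup_apply_eq hp
  refine ⟨⟨γ, hγ⟩, Subtype.ext (Homeomorph.ext (congrFun ?_))⟩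
  refine eq_of_comp_eq_of_locallyInjective (u.coverProj_locallyInjective k)
    (Homeomorph.continuous _) (Homeomorph.continuous _)
    (fun x => ((u.toDeck k ⟨γ, hγ⟩).2.2 x).trans (ψ.2.2 x).symm)
    (x := OrbitSpace.mk _ UpperHalfPlane.I) ?_
  rw [toDeck_apply_mk, hγw, hw]

end Uniformization


/-! ### Generating the Fuchsian group, and periods of functions. -/

namespace Uniformization

variable {S : Type*} [TopologicalSpace S] [ChartedSpace ℂ S] (u : Uniformization S)

/-- Let `Q` lift a quotient map `q` onto `S` to the hyperbolic plane. A subgroup of the Fuchsian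
group whose translations relate the lifts of any two points with the same image is everything. -/
theorem fuchsianGroup_le_of_lift [IsManifold 𝓘(ℂ) ω S] {D : Type*} [TopologicalSpace D]
    [Nonempty D] {q : D → S} (hq : Topology.IsQuotientMap q) {Q : D → ℍ} (hQ : Continuous Q)
    (hpQ : ∀ x, u.proj (Q x) = q x) {Γ' : Subgroup (ℍ ≃ₜ ℍ)} (hΓ' : Γ' ≤ u.fuchsianGroup)
    (h : ∀ x y, q x = q y → ∃ δ ∈ Γ', δ (Q x) = Q y) : u.fuchsianGroup ≤ Γ' := by
  -- `U` is the union of the `Γ'`-translates of the image of `Q`; it is shown to be open and closed,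
  -- hence all of `ℍ`.
  let U : Set ℍ := {z | ∃ γ ∈ Γ', ∃ x, γ (Q x) = z}
  have hU : ∀ γ ∈ u.fuchsianGroup, ∀ x, γ (Q x) ∈ U ↔ γ ∈ Γ' := by
    refine fun γ hγ x => ⟨?_, fun hγ' => ⟨γ, hγ', x, rfl⟩⟩
    rintro ⟨γ', hγ', y, hy⟩
    have hxy : q x = q y := by
      rw [← hpQ, ← hpQ, ← u.proj_apply hγ, ← hy, u.proj_apply (hΓ' hγ')]
    obtain ⟨δ, hδ, hδx⟩ := h x y hxy
    have hγδ : γ = γ' * δ := u.fuchsianGroup_ext hγ (mul_mem (hΓ' hγ') (hΓ' hδ)) (z := Q x) (by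
      rw [← hy, ← hδx]
      rfl)
    exact hγδ ▸ mul_mem hγ' hδ
  have hlc : ∀ z, ∀ᶠ w in 𝓝 z, (w ∈ U ↔ z ∈ U) := by
    intro z
    obtain ⟨e, hz, he⟩ := u.isCoveringMap.isLocalHomeomorph z
    -- Openness of `T` is tested on `D` through the quotient map: near `x` the local section `e.symm
    -- ∘ q` is `γ ∘ Q` for one fixed `γ`, and by `hU` membership of `γ (Q y)` in `U` does not depend
    -- on `y`.
    let T : Set S := {s | s ∈ e.target ∧ (e.symm s ∈ U ↔ z ∈ U)}
    have hT : IsOpen T := by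
      rw [← hq.isOpen_preimage, isOpen_iff_mem_nhds]
      rintro x ⟨hx, hxU⟩
      obtain ⟨γ, hγ, hγx⟩ := u.exists_fuchsianGroup_apply_eq (z := Q x) (w := e.symm (q x)) (by
        rw [hpQ, he, e.right_inv hx])
      have hsrc : e.source ∈ 𝓝 (γ (Q x)) := by
        rw [hγx]
        exact e.open_source.mem_nhds (e.map_target hx)
      filter_upwards [(γ.continuous.comp hQ).continuousAt hsrc] with y hy
      have hey : e (γ (Q y)) = q y := by rw [← he, u.proj_apply hγ, hpQ]
      have hσ : e.symm (q y) = γ (Q y) := by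
        rw [← hey]
        exact e.left_inv hy
      refine ⟨hey ▸ e.map_source hy, ?_⟩
      rw [hσ, hU γ hγ, ← hU γ hγ x, hγx, hxU]
    have hzT : e z ∈ T := ⟨e.map_source hz, by rw [e.left_inv hz]⟩
    filter_upwards [e.open_source.mem_nhds hz, (e.continuousAt hz) (hT.mem_nhds hzT)]
      with w hw hwT
    have h1 := hwT.2
    rwa [e.left_inv hw] at h1
  have hopen : IsOpen U := isOpen_iff_mem_nhds.2 fun z hz => by
    filter_upwards [hlc z] with w hw using hw.2 hz
  have hclosed : IsClosed U := ⟨isOpen_iff_mem_nhds.2 fun z hz => by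
    filter_upwards [hlc z] with w hw using fun h => hz (hw.1 h)⟩
  obtain ⟨x⟩ := ‹Nonempty D›
  have huniv : U = Set.univ := IsClopen.eq_univ ⟨hclosed, hopen⟩ ⟨Q x, 1, one_mem _, x, rfl⟩
  exact fun γ hγ => (hU γ hγ x).1 (huniv ▸ Set.mem_univ _)

/-- A real function on the hyperbolic plane which descends to `S` modulo `ℤ` has integral
periods. -/
theorem exists_period_hom {F : ℍ → ℝ} (hF : Continuous F) {G : S → UnitAddCircle}
    (hG : ∀ z, (F z : UnitAddCircle) = G (u.proj z)) :
    ∃ χ : u.fuchsianGroup →* Multiplicative ℤ, ∀ γ z, F (γ.1 z) = F z + ((χ γ).toAdd : ℝ) := by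
  have hex : ∀ γ : u.fuchsianGroup, ∃ n : ℤ, ∀ z, F (γ.1 z) = F z + n := by
    intro γ
    have h0 : ∀ z, ((F (γ.1 z) - F z : ℝ) : UnitAddCircle) = 0 := fun z => by
      rw [AddCircle.coe_sub, hG, hG, u.proj_apply γ.2, sub_self]
    obtain ⟨n, hn⟩ := (AddCircle.coe_eq_zero_iff 1).1 (h0 UpperHalfPlane.I)
    refine ⟨n, fun z => ?_⟩
    -- A continuous integer-valued function on the connected space `ℍ` is constant, so `n` does not
    -- depend on the point.
    have hconst := (AddCircle.isCoveringMap_coe (1 : ℝ)).const_of_comp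
      (g := fun z => F (γ.1 z) - F z) ((hF.comp γ.1.continuous).sub hF)
      (fun z w => (h0 z).trans (h0 w).symm) z UpperHalfPlane.I
    simp only [← hn, zsmul_eq_mul, mul_one] at hconst
    linarith
  choose n hn using hex
  refine ⟨⟨⟨fun γ => Multiplicative.ofAdd (n γ), ?_⟩, ?_⟩, hn⟩
  · have h := hn 1 UpperHalfPlane.I
    change F UpperHalfPlane.I = _ at h
    rw [ofAdd_eq_one]
    exact_mod_cast (by linarith : (n 1 : ℝ) = 0)
  · intro γ γ'
    have h := hn (γ * γ') UpperHalfPlane.I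
    change F (γ.1 (γ'.1 UpperHalfPlane.I)) = _ at h
    rw [hn, hn] at h
    rw [← ofAdd_add]
    refine congrArg Multiplicative.ofAdd ?_
    exact_mod_cast (by linarith : (n (γ * γ') : ℝ) = n γ + n γ')

end Uniformization

/-! ### Functions on the polygon with prescribed jumps across paired sides. -/

section Polygon

/-- The parameter of the first vertex of the first of the two identified sides with label `x`. -/
def sideStart {g : ℕ} (x : Fin 2 × Fin g) : ℝ := 4 * (x.2 : ℝ) + (x.1 : ℝ)

theorem polygonRel_sideStart {g : ℕ} (x : Fin 2 × Fin g) {t : ℝ} (ht : t ∈ Set.Icc (0 : ℝ) 1) :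
    PolygonRel g (polygonPoint g (sideStart x + t)) (polygonPoint g (sideStart x + 3 - t)) := by
  obtain ⟨i, j⟩ := x
  fin_cases i
  · simpa [sideStart] using PolygonRel.a j t ht
  · have h := PolygonRel.b j t ht
    rw [show 4 * (j : ℝ) + 4 - t = 4 * (j : ℝ) + 1 + 3 - t by ring] at h
    simpa [sideStart] using h

theorem PolygonRel.exists_sideStart {g : ℕ} {p q : Metric.closedBall (0 : ℂ) 1}
    (h : PolygonRel g p q) : ∃ (x : Fin 2 × Fin g) (t : ℝ), t ∈ Set.Icc (0 : ℝ) 1 ∧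
      p = polygonPoint g (sideStart x + t) ∧ q = polygonPoint g (sideStart x + 3 - t) := by
  cases h with
  | a j t ht => exact ⟨(0, j), t, ht, by simp [sideStart], by simp [sideStart]⟩
  | b j t ht =>
    refine ⟨(1, j), t, ht, by simp [sideStart], ?_⟩
    rw [show 4 * (j : ℝ) + 4 - t = 4 * (j : ℝ) + 1 + 3 - t by ring]
    simp [sideStart]

theorem continuous_polygonPoint (g : ℕ) : Continuous (polygonPoint g) := by
  unfold polygonPoint
  fun_prop

/-- A continuous function on the boundary of the polygon extends to the polygon. -/
theorem exists_extension_polygon {g : ℕ} (hg : 1 ≤ g) {f : ℝ → ℝ} (hf : Continuous f)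
    (h0 : f 0 = f (4 * g)) : ∃ F : Metric.closedBall (0 : ℂ) 1 → ℝ, Continuous F ∧
      ∀ s ∈ Set.Icc (0 : ℝ) (4 * g), F (polygonPoint g s) = f s := by
  have hg' : (0 : ℝ) < 4 * g := by positivity
  have : Fact ((0 : ℝ) < 4 * g) := ⟨hg'⟩
  let E : AddCircle (4 * g : ℝ) → Metric.closedBall (0 : ℂ) 1 := fun a =>
    ⟨AddCircle.toCircle a, by rw [mem_closedBall_zero_iff, Circle.norm_coe]⟩
  have hEc : Continuous E :=
    (continuous_subtype_val.comp AddCircle.continuous_toCircle).subtype_mk _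
  have hEi : Function.Injective E := fun a b hab =>
    AddCircle.injective_toCircle hg'.ne' (Subtype.ext (Subtype.mk.inj hab))
  have hE : ∀ s : ℝ, E s = polygonPoint g s := fun s => by
    refine Subtype.ext ?_
    change ((AddCircle.toCircle (s : AddCircle (4 * g : ℝ)) : Circle) : ℂ) = _
    rw [AddCircle.toCircle_apply_mk, Circle.coe_exp, polygonPoint,
      show 2 * Real.pi / (4 * g) * s = 2 * Real.pi * s / (4 * g) by ring]
  let φ : C(AddCircle (4 * g : ℝ), ℝ) :=
    ⟨AddCircle.liftIco (4 * g : ℝ) 0 f, AddCircle.liftIco_zero_continuous h0 hf.continuousOn⟩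
  -- Tietze extension from the boundary circle, of length `4g`, to the disc.
  obtain ⟨F, -, hF⟩ := φ.exists_extension_forall_mem_of_isClosedEmbedding (t := Set.univ)
    (fun _ => Set.mem_univ _) Set.univ_nonempty (hEc.isClosedEmbedding hEi)
  have hFs : ∀ s ∈ Set.Ico (0 : ℝ) (4 * g), F (polygonPoint g s) = f s := fun s hs => by
    rw [← hE]
    exact (congrFun hF s).trans (AddCircle.liftIco_zero_coe_apply hs)
  refine ⟨F, F.continuous, fun s hs => ?_⟩
  rcases hs.2.lt_or_eq with h | rfl
  · exact hFs s ⟨hs.1, h⟩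
  · rw [← h0, ← hFs 0 ⟨le_rfl, hg'⟩, ← hE, ← hE, AddCircle.coe_period]
    rfl

/-- The trapezoidal function which rises from `0` to `1` on `[m, m + 1]` and falls from `1` to `0`
on `[m + 2, m + 3]`. -/
def trapezoid (m s : ℝ) : ℝ := max 0 (min 1 (min (s - m) (m + 3 - s)))

theorem continuous_trapezoid (m : ℝ) : Continuous (trapezoid m) := by
  unfold trapezoid
  fun_prop

theorem trapezoid_of_le {m s : ℝ} (h : s ≤ m) : trapezoid m s = 0 :=
  max_eq_left (min_le_of_right_le (min_le_of_left_le (by linarith)))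

theorem trapezoid_of_ge {m s : ℝ} (h : m + 3 ≤ s) : trapezoid m s = 0 :=
  max_eq_left (min_le_of_right_le (min_le_of_right_le (by linarith)))

theorem trapezoid_symm (m s : ℝ) : trapezoid m (2 * m + 3 - s) = trapezoid m s := by
  unfold trapezoid
  rw [min_comm (s - m)]
  congr 3 <;> ring

theorem trapezoid_of_mem {m s : ℝ} (h : s ∈ Set.Icc (m + 1) (m + 2)) : trapezoid m s = 1 := by
  unfold trapezoid
  rw [min_eq_left (le_min (by linarith [h.1]) (by linarith [h.2])), max_eq_right zero_le_one]

/-- The boundary values of a function on the polygon whose period along the side with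
label `x` is `1` and whose other periods vanish. -/
def boundaryValue {g : ℕ} (x : Fin 2 × Fin g) (s : ℝ) : ℝ :=
  if x.1 = 0 then trapezoid (4 * (x.2 : ℝ) + 1) s else -trapezoid (4 * (x.2 : ℝ)) s

theorem continuous_boundaryValue {g : ℕ} (x : Fin 2 × Fin g) : Continuous (boundaryValue x) := by
  unfold boundaryValue
  split_ifs
  · exact continuous_trapezoid _
  · exact (continuous_trapezoid _).neg

theorem fin_cast_add_one_le {g : ℕ} (j : Fin g) : (j : ℝ) + 1 ≤ g := by exact_mod_cast j.2

theorem boundaryValue_zero_eq {g : ℕ} (x : Fin 2 × Fin g) :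
    boundaryValue x 0 = boundaryValue x (4 * g) := by
  have h1 := fin_cast_add_one_le x.2
  have h2 : (0 : ℝ) ≤ x.2 := Nat.cast_nonneg _
  unfold boundaryValue
  rw [trapezoid_of_le (by linarith), trapezoid_of_le (by linarith), trapezoid_of_ge (by linarith),
    trapezoid_of_ge (by linarith)]

/-- On another handle the trapezoid vanishes. On the same handle, it is placed symmetrically about
the pair of sides with the other label, so no jump occurs there, while on the two sides labelled `x`
it is constant, `0` on one and `1` on the other. The sign in `boundaryValue` makes the jump `+1` for
both kinds of label. -/
theorem boundaryValue_sideStart {g : ℕ} (x y : Fin 2 × Fin g) {t : ℝ}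
    (ht : t ∈ Set.Icc (0 : ℝ) 1) :
    boundaryValue x (sideStart y + 3 - t) =
      boundaryValue x (sideStart y + t) + if x = y then 1 else 0 := by
  obtain ⟨ht0, ht1⟩ := ht
  obtain ⟨i, j⟩ := x
  obtain ⟨i', j'⟩ := y
  rcases lt_trichotomy j j' with h | rfl | h
  · have h' : (j : ℝ) + 1 ≤ j' := by exact_mod_cast h
    fin_cases i <;> fin_cases i' <;>
      simp only [boundaryValue, sideStart, Prod.mk.injEq, h.ne, and_false, if_false] <;>
      norm_num <;>
      rw [trapezoid_of_ge (by linarith), trapezoid_of_ge (by linarith)]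
  · fin_cases i <;> fin_cases i' <;>
      simp only [boundaryValue, sideStart, Prod.mk.injEq] <;> norm_num
    · rw [trapezoid_of_mem ⟨by linarith, by linarith⟩, trapezoid_of_le (by linarith)]
      norm_num
    · rw [← trapezoid_symm]
      congr 1
      ring
    · rw [← trapezoid_symm]
      congr 1
      ring
    · rw [trapezoid_of_ge (by linarith), trapezoid_of_mem ⟨by linarith, by linarith⟩]
      norm_num
  · have h' : (j' : ℝ) + 1 ≤ j := by exact_mod_cast h
    fin_cases i <;> fin_cases i' <;>
      simp only [boundaryValue, sideStart, Prod.mk.injEq, h.ne', and_false, if_false] <;>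
      norm_num <;>
      rw [trapezoid_of_le (by linarith), trapezoid_of_le (by linarith)]

end Polygon


section PolygonProj

instance : ContractibleSpace (Metric.closedBall (0 : ℂ) 1) :=
  (convex_closedBall (0 : ℂ) 1).contractibleSpace ⟨0, Metric.mem_closedBall_self zero_le_one⟩

instance : LocallyPathConnectedSpace (Metric.closedBall (0 : ℂ) 1) :=
  (convex_closedBall (0 : ℂ) 1).locallyPathConnectedSpace

variable {S : Type*} [TopologicalSpace S]

/-- The projection of the polygon onto a surface homeomorphic to the closed surface of
genus `g`. -/
def polygonProj {g : ℕ} (Φ : S ≃ₜ ClosedSurface g) (p : Metric.closedBall (0 : ℂ) 1) : S :=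
  Φ.symm (Quot.mk (PolygonRel g) p)

theorem isQuotientMap_polygonProj {g : ℕ} (Φ : S ≃ₜ ClosedSurface g) :
    Topology.IsQuotientMap (polygonProj Φ) :=
  Φ.symm.isQuotientMap.comp isQuotientMap_quot_mk

theorem apply_polygonProj {g : ℕ} (Φ : S ≃ₜ ClosedSurface g) (p : Metric.closedBall (0 : ℂ) 1) :
    Φ (polygonProj Φ p) = Quot.mk (PolygonRel g) p :=
  Φ.apply_symm_apply _

end PolygonProj

/-! ### Side pairings, their dual homomorphisms, and the closed case. -/

namespace Uniformization

variable {S : Type*} [TopologicalSpace S] [ChartedSpace ℂ S] (u : Uniformization S)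

/-- The side pairings of a lift of the polygon to the hyperbolic plane. -/
theorem exists_sidePairing [IsManifold 𝓘(ℂ) ω S] {g : ℕ} {Φ : S ≃ₜ ClosedSurface g}
    {Q : Metric.closedBall (0 : ℂ) 1 → ℍ} (hQ : Continuous Q)
    (hpQ : ∀ p, u.proj (Q p) = polygonProj Φ p) (x : Fin 2 × Fin g) :
    ∃ γ : u.fuchsianGroup, ∀ t ∈ Set.Icc (0 : ℝ) 1,
      γ.1 (Q (polygonPoint g (sideStart x + t))) = Q (polygonPoint g (sideStart x + 3 - t)) := by
  have hpt : ∀ t ∈ Set.Icc (0 : ℝ) 1, u.proj (Q (polygonPoint g (sideStart x + t))) =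
      u.proj (Q (polygonPoint g (sideStart x + 3 - t))) := fun t ht => by
    rw [hpQ, hpQ]
    exact congrArg Φ.symm (Quot.sound (polygonRel_sideStart x ht))
  have h0 : (0 : ℝ) ∈ Set.Icc (0 : ℝ) 1 := ⟨le_rfl, zero_le_one⟩
  obtain ⟨γ, hγ, hγ0⟩ := u.exists_fuchsianGroup_apply_eq (hpt 0 h0)
  have hc := continuous_polygonPoint g
  have h1 : Continuous fun t : ℝ => γ (Q (polygonPoint g (sideStart x + t))) := by fun_prop
  have h2 : Continuous fun t : ℝ => Q (polygonPoint g (sideStart x + 3 - t)) := by fun_prop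
  -- The element `γ` chosen at `t = 0` works along the whole side, since both paths lift the same
  -- path in `S`.
  exact ⟨⟨γ, hγ⟩, u.isCoveringMap.eqOn_of_comp_eqOn isPreconnected_Icc h1.continuousOn
    h2.continuousOn (fun t ht => (u.proj_apply hγ _).trans (hpt t ht)) h0 hγ0⟩

/-- The side pairings of a lift of the polygon generate the Fuchsian group. -/
theorem closure_range_sidePairing [IsManifold 𝓘(ℂ) ω S] {g : ℕ} {Φ : S ≃ₜ ClosedSurface g}
    {Q : Metric.closedBall (0 : ℂ) 1 → ℍ} (hQ : Continuous Q)
    (hpQ : ∀ p, u.proj (Q p) = polygonProj Φ p) {b : Fin 2 × Fin g → u.fuchsianGroup}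
    (hb : ∀ x, ∀ t ∈ Set.Icc (0 : ℝ) 1, (b x).1 (Q (polygonPoint g (sideStart x + t))) =
      Q (polygonPoint g (sideStart x + 3 - t))) :
    Subgroup.closure (Set.range b) = ⊤ := by
  let Γ' : Subgroup (ℍ ≃ₜ ℍ) := (Subgroup.closure (Set.range b)).map u.fuchsianGroup.subtype
  have hΓ' : Γ' ≤ u.fuchsianGroup := by
    rintro _ ⟨γ, -, rfl⟩
    exact γ.2
  have hle : u.fuchsianGroup ≤ Γ' := by
    refine u.fuchsianGroup_le_of_lift (isQuotientMap_polygonProj Φ) hQ hpQ hΓ' fun p q hpq => ?_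
    -- Points of the polygon with the same image are joined by a chain of side identifications; the
    -- matching chain of side pairings composes to the required `δ`.
    have hgen : Relation.EqvGen (PolygonRel g) p q := Quot.eqvGen_exact (Φ.symm.injective hpq)
    clear hpq
    induction hgen with
    | rel p q h =>
      obtain ⟨x, t, ht, rfl, rfl⟩ := h.exists_sideStart
      exact ⟨b x, ⟨b x, Subgroup.subset_closure ⟨x, rfl⟩, rfl⟩, hb x t ht⟩
    | refl p => exact ⟨1, one_mem _, rfl⟩
    | symm p q _ ih =>
      obtain ⟨δ, hδ, h⟩ := ih
      exact ⟨δ⁻¹, inv_mem hδ, by rw [← h]; exact δ.symm_apply_apply _⟩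
    | trans p q r _ _ ih ih' =>
      obtain ⟨δ, hδ, h⟩ := ih
      obtain ⟨δ', hδ', h'⟩ := ih'
      exact ⟨δ' * δ, mul_mem hδ' hδ, by rw [← h', ← h]; rfl⟩
  refine eq_top_iff.2 fun γ _ => ?_
  obtain ⟨γ', hγ', h⟩ := hle γ.2
  rwa [← Subtype.ext h]

theorem sideStart_add_mem {g : ℕ} (x : Fin 2 × Fin g) {t : ℝ} (ht : t ∈ Set.Icc (0 : ℝ) 3) :
    sideStart x + t ∈ Set.Icc (0 : ℝ) (4 * g) := by
  have h1 := fin_cast_add_one_le x.2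
  have h2 := fin_cast_add_one_le x.1
  have h3 : (0 : ℝ) ≤ x.2 := Nat.cast_nonneg _
  have h4 : (0 : ℝ) ≤ x.1 := Nat.cast_nonneg _
  push_cast at h2
  unfold sideStart
  exact ⟨by linarith [ht.1], by linarith [ht.2]⟩

/-- The homomorphisms to `ℤ` dual to the side pairings of a lift of the polygon. -/
theorem exists_dual_hom {g : ℕ} (hg : 1 ≤ g) {Φ : S ≃ₜ ClosedSurface g}
    {Q : Metric.closedBall (0 : ℂ) 1 → ℍ} (hQ : Continuous Q)
    (hpQ : ∀ p, u.proj (Q p) = polygonProj Φ p) {b : Fin 2 × Fin g → u.fuchsianGroup}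
    (hb : ∀ x, ∀ t ∈ Set.Icc (0 : ℝ) 1, (b x).1 (Q (polygonPoint g (sideStart x + t))) =
      Q (polygonPoint g (sideStart x + 3 - t))) (x : Fin 2 × Fin g) :
    ∃ χ : u.fuchsianGroup →* Multiplicative ℤ,
      ∀ y, χ (b y) = Multiplicative.ofAdd (if x = y then 1 else 0) := by
  obtain ⟨f, hf, hfs⟩ := exists_extension_polygon hg (continuous_boundaryValue x)
    (boundaryValue_zero_eq x)
  have hf0 : ∀ y, ∀ t ∈ Set.Icc (0 : ℝ) 1, f (polygonPoint g (sideStart y + 3 - t)) =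
      f (polygonPoint g (sideStart y + t)) + if x = y then 1 else 0 := fun y t ht => by
    rw [add_sub_assoc, hfs _ (sideStart_add_mem y ⟨by linarith [ht.2], by linarith [ht.1]⟩),
      ← add_sub_assoc, hfs _ (sideStart_add_mem y ⟨ht.1, by linarith [ht.2]⟩),
      boundaryValue_sideStart x y ht]
  -- All jumps of `f` across paired sides are integers, so `f` descends to the surface modulo `ℤ`.
  let G₀ : ClosedSurface g → UnitAddCircle := Quot.lift (fun p => (f p : UnitAddCircle)) (by
    intro p q h
    obtain ⟨y, t, ht, rfl, rfl⟩ := h.exists_sideStart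
    rw [hf0 y t ht]
    split_ifs <;> simp)
  have hG₀ : Continuous G₀ :=
    continuous_quot_lift _ ((AddCircle.isCoveringMap_coe (1 : ℝ)).continuous.comp hf)
  obtain ⟨r, hr⟩ := QuotientAddGroup.mk_surjective (G₀ (Φ (u.proj UpperHalfPlane.I)))
  obtain ⟨F, ⟨-, hF⟩, -⟩ := (AddCircle.isCoveringMap_coe (1 : ℝ)).existsUnique_continuousMap_lifts
    (⟨fun z => G₀ (Φ (u.proj z)), hG₀.comp (Φ.continuous.comp u.isCoveringMap.continuous)⟩ :
      C(ℍ, UnitAddCircle)) UpperHalfPlane.I r hr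
  have hFz : ∀ z, (F z : UnitAddCircle) = G₀ (Φ (u.proj z)) := congrFun hF
  obtain ⟨χ, hχ⟩ := u.exists_period_hom F.continuous (G := fun s => G₀ (Φ s)) hFz
  have hFf : ∀ p, ((F (Q p) - f p : ℝ) : UnitAddCircle) = 0 := fun p => by
    rw [AddCircle.coe_sub, hFz, hpQ, apply_polygonProj]
    exact sub_self _
  -- `F ∘ Q` and `f` differ by a constant integer, so the period of `F` along `b y` is the jump of
  -- `f` across the side `y`.
  have hconst := (AddCircle.isCoveringMap_coe (1 : ℝ)).const_of_comp
    (g := fun p => F (Q p) - f p) ((F.continuous.comp hQ).sub hf)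
    (fun p q => (hFf p).trans (hFf q).symm)
  refine ⟨χ, fun y => Multiplicative.toAdd.injective ?_⟩
  have h0 : (0 : ℝ) ∈ Set.Icc (0 : ℝ) 1 := ⟨le_rfl, zero_le_one⟩
  have h1 := hχ (b y) (Q (polygonPoint g (sideStart y + 0)))
  rw [hb y 0 h0] at h1
  have h2 := hconst (polygonPoint g (sideStart y + 3 - 0)) (polygonPoint g (sideStart y + 0))
  have h3 := hf0 y 0 h0
  have h4 : ((χ (b y)).toAdd : ℝ) = if x = y then 1 else 0 := by
    linarith
  rw [toAdd_ofAdd]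
  split_ifs at h4 ⊢ <;> exact_mod_cast h4

/-- The deck group of the `k`-homology cover of the closed surface of genus `g`. -/
theorem nonempty_deck_mulEquiv [T2Space S] [IsManifold 𝓘(ℂ) ω S] (k : ℕ∞) {g : ℕ} (hg : 1 ≤ g)
    (Φ : S ≃ₜ ClosedSurface g) :
    Nonempty (u.deck k ≃* Multiplicative (Fin (2 * g) → ZModInf k)) := by
  let p₀ : Metric.closedBall (0 : ℂ) 1 := ⟨0, Metric.mem_closedBall_self zero_le_one⟩
  obtain ⟨z₀, hz₀⟩ := u.surjective (polygonProj Φ p₀)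
  obtain ⟨Q, hQ, -, hpQ⟩ :=
    u.exists_continuous_lift (isQuotientMap_polygonProj Φ).continuous hz₀
  choose b hb using u.exists_sidePairing hQ hpQ
  choose χ hχ using u.exists_dual_hom hg hQ hpQ hb
  obtain ⟨μ⟩ := nonempty_mulEquiv_of_dual b (u.closure_range_sidePairing hQ hpQ hb) χ hχ
    (u.toDeck k) (u.toDeck_surjective k) (u.ker_toDeck k)
  let ε : (Fin 2 × Fin g → ZModInf k) ≃+ (Fin (2 * g) → ZModInf k) :=
    { Equiv.piCongrLeft' (fun _ => ZModInf k) finProdFinEquiv with map_add' := fun _ _ => rfl }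
  exact ⟨μ.trans ε.toMultiplicative⟩

/-! ### The group of lifts when all relator values are trivial. -/

variable {u} {k : ℕ∞} {L : Subgroup (autGroup S)}

theorem ker_theta : (u.theta k L).ker = (u.deck k).subgroupOf (u.liftGroup k L) := by
  ext ψ
  rw [MonoidHom.mem_ker, Subgroup.mem_subgroupOf]
  exact ⟨u.coe_mem_deck k L, fun h => u.eq_of_lifts k L (u.theta_spec k L ψ) h.2⟩

namespace GeneratorLifts

variable {J I : Type*} {P : GroupPresentation L J I} (c : u.GeneratorLifts k P)

theorem theta_comp_lift : (u.theta k L).comp (FreeGroup.lift c.lift) = FreeGroup.lift P.gen := by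
  ext j
  simp [c.theta_lift]

/-- If all relator values are trivial, then the choice of the lifts of the generators extends to
a section of `θ_k`. -/
theorem exists_section (hm : ∀ i, c.relatorValue i = 1) :
    ∃ s : L →* u.liftGroup k L, (∀ x, u.theta k L (s x) = x) ∧
      s.range = Subgroup.closure (Set.range c.lift) := by
  -- The kernel on the left is the normal closure of the relators, each of which is killed on the
  -- right by `hm`.
  have hker : (FreeGroup.lift P.gen).ker ≤ (FreeGroup.lift c.lift).ker := by
    rw [P.ker_lift]
    refine Subgroup.normalClosure_le_normal ?_
    rintro _ ⟨i, rfl⟩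
    exact hm i
  let s : L →* u.liftGroup k L := (FreeGroup.lift P.gen).liftOfSurjective P.lift_surjective
    ⟨FreeGroup.lift c.lift, hker⟩
  have hs : ∀ w, s (FreeGroup.lift P.gen w) = FreeGroup.lift c.lift w := fun w =>
    MonoidHom.liftOfRightInverse_comp_apply _ _ _ ⟨FreeGroup.lift c.lift, hker⟩ w
  refine ⟨s, fun x => ?_, ?_⟩
  · obtain ⟨w, rfl⟩ := P.lift_surjective x
    rw [hs]
    exact DFunLike.congr_fun c.theta_comp_lift w
  · rw [← FreeGroup.range_lift_eq_closure]
    ext ψ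
    constructor
    · rintro ⟨x, rfl⟩
      obtain ⟨w, rfl⟩ := P.lift_surjective x
      exact ⟨w, (hs w).symm⟩
    · rintro ⟨w, rfl⟩
      exact ⟨_, hs w⟩

theorem relatorSubgroup_eq_bot (hm : ∀ i, c.relatorValue i = 1) : c.relatorSubgroup = ⊥ := by
  refine le_bot_iff.1 (sInf_le ⟨bot_le, fun ψ _ n hn => ?_, fun i => ?_⟩)
  · rw [Subgroup.mem_bot.1 hn, mul_one, mul_inv_cancel]
    exact one_mem _
  · rw [hm]
    exact one_mem _

theorem toQuotient_bijective (hm : ∀ i, c.relatorValue i = 1) :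
    Function.Bijective c.toQuotient := by
  refine ⟨(injective_iff_map_eq_one _).2 fun ψ hψ => ?_, QuotientGroup.mk'_surjective _⟩
  have h := (QuotientGroup.eq_one_iff ψ).1 hψ
  rw [Subgroup.mem_subgroupOf, c.relatorSubgroup_eq_bot hm] at h
  exact Subtype.ext h

theorem comap_hatGroup (hm : ∀ i, c.relatorValue i = 1) :
    c.hatGroup.comap c.toQuotient = Subgroup.closure (Set.range c.lift) :=
  Subgroup.comap_map_eq_self_of_injective (c.toQuotient_bijective hm).1 _

/-- Orbits of the trivial group are points, and the inverse of the projection is holomorphic because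
it is induced by the identity. -/
theorem exists_homeomorph_W [T2Space S] (hm : ∀ i, c.relatorValue i = 1) :
    ∃ h : u.Cover k ≃ₜ c.W, (∀ x, h x = OrbitSpace.mk c.relatorSubgroup x) ∧
      IsBiholomorphic h := by
  have hinj : Function.Injective (OrbitSpace.mk c.relatorSubgroup) := fun x y hxy => by
    obtain ⟨g, hg, rfl⟩ := OrbitSpace.mk_eq_mk.1 hxy
    rw [c.relatorSubgroup_eq_bot hm, Subgroup.mem_bot] at hg
    rw [hg]
    rfl
  let h : u.Cover k ≃ₜ c.W :=
    (Equiv.ofBijective _ ⟨hinj, OrbitSpace.mk_surjective⟩).toHomeomorphOfContinuousOpen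
      OrbitSpace.continuous_mk OrbitSpace.isOpenMap_mk
  refine ⟨h, fun _ => rfl, OrbitSpace.mdifferentiable_mk _,
    OrbitSpace.mdifferentiable_of_comp_mk ?_⟩
  have : h.symm ∘ OrbitSpace.mk c.relatorSubgroup = id := funext h.symm_apply_apply
  rw [this]
  exact mdifferentiable_id

/-- The group `L̂` is isomorphic to `L` through `θ_k`. -/
theorem exists_hatGroup_mulEquiv (hm : ∀ i, c.relatorValue i = 1) :
    ∃ f : c.hatGroup ≃* L, ∀ (ψ : u.liftGroup k L) (hψ : c.toQuotient ψ ∈ c.hatGroup),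
      f ⟨c.toQuotient ψ, hψ⟩ = u.theta k L ψ := by
  obtain ⟨s, hs, hsr⟩ := c.exists_section hm
  have hinj : Function.Injective (c.toQuotient.comp s) :=
    (c.toQuotient_bijective hm).1.comp (Function.LeftInverse.injective hs)
  have hrange : (c.toQuotient.comp s).range = c.hatGroup := by
    rw [MonoidHom.range_comp, hsr]
    rfl
  let f := (MonoidHom.ofInjective hinj).trans (MulEquiv.subgroupCongr hrange)
  refine ⟨f.symm, fun ψ hψ => ?_⟩
  have hψ' : ψ ∈ s.range := by
    rw [hsr, ← c.comap_hatGroup hm]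
    exact hψ
  obtain ⟨x, rfl⟩ := hψ'
  rw [hs, MulEquiv.symm_apply_eq]
  rfl

end GeneratorLifts

end Uniformization

end HomologyCover

/-! ### The main theorem. -/

theorem mainTheorem7 {S : Type*} [TopologicalSpace S] [T2Space S] [ConnectedSpace S]
    [ChartedSpace ℂ S] [IsManifold 𝓘(ℂ) ω S] (hS : HomologyCover.IsNonexceptional S)
    (u : HomologyCover.Uniformization S) (k : ℕ∞) (hk : 2 ≤ k)
    (L : Subgroup (HomologyCover.autGroup S)) {J I : Type*}
    (P : HomologyCover.GroupPresentation L J I) (c : u.GeneratorLifts k P)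
    (hm : ∀ i, c.relatorValue i = 1) :
    c.relatorSubgroup = ⊥ ∧
    (∃ h : u.Cover k ≃ₜ c.W, (∀ x, h x = HomologyCover.OrbitSpace.mk c.relatorSubgroup x) ∧
      HomologyCover.IsBiholomorphic h) ∧
    Function.Bijective c.toQuotient ∧
    (∃ f : c.hatGroup ≃* L, ∀ (ψ : u.liftGroup k L) (hψ : c.toQuotient ψ ∈ c.hatGroup),
      f ⟨c.toQuotient ψ, hψ⟩ = u.theta k L ψ) ∧
    ((u.deck k).subgroupOf (u.liftGroup k L)).Normal ∧
    Subgroup.IsComplement' ((u.deck k).subgroupOf (u.liftGroup k L))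
      (c.hatGroup.comap c.toQuotient) ∧
    (∃ (α : L →* MulAut (u.deck k)) (e : u.liftGroup k L ≃* u.deck k ⋊[α] L),
      (∀ m, e (Subgroup.inclusion (u.deck_le_liftGroup k L) m) = SemidirectProduct.inl m) ∧
      (∀ ψ, (e ψ).right = u.theta k L ψ) ∧
      ∀ ψ ∈ c.hatGroup.comap c.toQuotient, e ψ = SemidirectProduct.inr (u.theta k L ψ)) ∧
    ∀ g : ℕ, 1 ≤ g → Nonempty (S ≃ₜ HomologyCover.ClosedSurface g) →
      ∃ (μ : u.deck k ≃* Multiplicative (Fin (2 * g) → HomologyCover.ZModInf k))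
        (β : L →* MulAut (Multiplicative (Fin (2 * g) → HomologyCover.ZModInf k)))
        (e : u.liftGroup k L ≃* Multiplicative (Fin (2 * g) → HomologyCover.ZModInf k) ⋊[β] L),
        (∀ m, e (Subgroup.inclusion (u.deck_le_liftGroup k L) m) =
          SemidirectProduct.inl (μ m)) ∧
        ∀ ψ, (e ψ).right = u.theta k L ψ := by
  obtain ⟨s, hs, hsr⟩ := c.exists_section hm
  have hcomap := (c.comap_hatGroup hm).trans hsr.symm
  have hker := HomologyCover.Uniformization.ker_theta (u := u) (k := k) (L := L)
  have hrange : (Subgroup.inclusion (u.deck_le_liftGroup k L)).range = (u.theta k L).ker := by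
    rw [hker, Subgroup.inclusion_range]
  obtain ⟨α, e, he₁, he₂, he₃⟩ := HomologyCover.exists_mulEquiv_semidirectProduct _
    (Subgroup.inclusion_injective (u.deck_le_liftGroup k L)) _ hrange s hs
  refine ⟨c.relatorSubgroup_eq_bot hm, c.exists_homeomorph_W hm, c.toQuotient_bijective hm,
    c.exists_hatGroup_mulEquiv hm, ?_, ?_, ⟨α, e, he₁, he₂, ?_⟩, ?_⟩
  · rw [← hker]
    infer_instance
  · rw [hcomap, ← hker]
    exact HomologyCover.isComplement'_range_of_section _ s hs
  · rw [hcomap]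
    rintro _ ⟨x, rfl⟩
    rw [he₃, hs]
  · rintro g hg ⟨Φ⟩
    obtain ⟨μ⟩ := u.nonempty_deck_mulEquiv k hg Φ
    -- The action `β` is `α` transported along `μ`; the factor `L` is untouched, so `he₂` still
    -- describes the projection.
    refine ⟨μ, _, e.trans (SemidirectProduct.congr' μ (MulEquiv.refl L)), fun m => ?_, he₂⟩
    rw [MulEquiv.trans_apply, he₁]
    rfl
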